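/- Let $q$ be a prime power and let $F_{q^3}/F_q$ be the cubic extension of the finite field with $q$ elements. For $a,b\in F_{q^3}$ put $P_{a,b}=(a,a^q,a^{q^2},b^{q^2},b^q,b)\in F_{q^3}^6$ and let $W=\{P_{a,b} : a,b\in F_{q^3}\}$, an $F_q$-vector space, with projective space $PG(W)$, whose points are the one-dimensional $F_q$-subspaces of $W$ (for $(a,b)\neq(0,0)$ the point spanned by $P_{a,b}$ is also denoted $P_{a,b}$). Let $$\beta(x,y)=x_0y_5+x_1y_4+x_2y_3-x_3y_2-x_4y_1-x_5y_0 ,$$ which takes values in $F_q$ on $W$. For $x\in F_{q^3}^*$ let $D_x=\mathrm{diag}(x,x^q,x^{q^2},x^{-q^2},x^{-q},x^{-1})$, which maps $W$ to itself, and let $K$ be the group of projectivities of $PG(W)$ induced by the matrices $D_x$ with $N(x)=x^{q^2+q+1}=1$. Generators of the polar space of $\beta|_W$ are the maximal totally isotropic $F_q$-subspaces of $W$. A partial ovoid is a set of points of the polar space such that every generator contains at most one point of the set; it is maximal if it is not properly contained in another partial ovoid. Then: (i) $W$ has dimension $6$ over $F_q$ and $\beta|_W$ is a non-degenerate alternating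 $F_q$-bilinear form, so that it defines a symplectic polar space $W(5,q)$ in $PG(W)\cong PG(5,q)$; (ii) $K$ is cyclic of order $q^2+q+1$, and the matrices $D_x$ with $N(x)=1$ preserve $\beta|_W$; (iii) for every $c\in F_q\setminus\{0\}$, the orbit $\mathcal O=P_{1,c}^K$ is a partial ovoid of $W(5,q)$ of size $q^2+q+1$, and this partial ovoid is maximal. -/

import Mathlib

open scoped LinearAlgebra.Projectivization

noncomputable section

namespace SymplecticOvoid

/-! ### Polar space of a bilinear form, generators, partial ovoids -/

section PolarSpace

variable {F V : Type*} [Field F] [AddCommGroup V] [Module F V]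

/-- A subspace on which the form `B` vanishes identically. -/
def IsTotallyIsotropic (B : LinearMap.BilinForm F V) (U : Submodule F V) : Prop :=
  ∀ x ∈ U, ∀ y ∈ U, B x y = 0

/-- A generator of the polar space of `B`: a maximal totally isotropic subspace. -/
def IsGenerator (B : LinearMap.BilinForm F V) (U : Submodule F V) : Prop :=
  Maximal (IsTotallyIsotropic B) U

/-- A partial ovoid: a set of points of the polar space such that every generator
contains at most one point of the set. -/
def IsPartialOvoid (B : LinearMap.BilinForm F V) (O : Set (ℙ F V)) : Prop :=
  (∀ P ∈ O, IsTotallyIsotropic B P.submodule) ∧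
    ∀ G : Submodule F V, IsGenerator B G →
      ∀ P ∈ O, ∀ Q ∈ O, P.submodule ≤ G → Q.submodule ≤ G → P = Q

/-- A partial ovoid that is maximal with respect to inclusion. -/
def IsMaximalPartialOvoid (B : LinearMap.BilinForm F V) (O : Set (ℙ F V)) : Prop :=
  Maximal (IsPartialOvoid B) O

end PolarSpace

/-! ### The subgeometry, the symplectic form and the cyclic group -/

variable (F E : Type*) [Field F] [Fintype F] [Field E] [Algebra F E]

variable {E} in
/-- With `q = |F|`, the vector `P_{a,b} = (a, a^q, a^(q^2), b^(q^2), b^q, b)` of `E^6`. -/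
def vec (a b : E) : Fin 6 → E :=
  ![a, a ^ Fintype.card F, a ^ Fintype.card F ^ 2, b ^ Fintype.card F ^ 2, b ^ Fintype.card F, b]

variable {E} in
theorem add_pow_card_pow (k : ℕ) (a b : E) :
    (a + b) ^ Fintype.card F ^ k = a ^ Fintype.card F ^ k + b ^ Fintype.card F ^ k := by
  have h := map_add (FiniteField.frobeniusAlgHom F E ^ k) a b
  simpa [AlgHom.coe_pow, FiniteField.coe_frobeniusAlgHom, pow_iterate] using h

variable {E} in
theorem smul_pow_card_pow (k : ℕ) (r : F) (a : E) :
    (r • a) ^ Fintype.card F ^ k = r • a ^ Fintype.card F ^ k := by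
  rw [Algebra.smul_def, mul_pow, ← map_pow, FiniteField.pow_card_pow, ← Algebra.smul_def]

variable {E} in
theorem vec_add (a b a' b' : E) : vec F a b + vec F a' b' = vec F (a + a') (b + b') := by
  have h1 := add_pow_card_pow F 1 a a'
  have h2 := add_pow_card_pow F 1 b b'
  rw [pow_one] at h1 h2
  ext i
  fin_cases i <;> simp [vec, add_pow_card_pow, h1, h2]

variable {E} in
theorem vec_smul (r : F) (a b : E) : r • vec F a b = vec F (r • a) (r • b) := by
  have h1 := smul_pow_card_pow F 1 r a
  have h2 := smul_pow_card_pow F 1 r b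
  rw [pow_one] at h1 h2
  ext i
  fin_cases i <;> simp [vec, smul_pow_card_pow, h1, h2]

/-- With `q = |F|`, the `F`-vector subspace `{(a, a^q, a^(q^2), b^(q^2), b^q, b)}` of `E^6`. -/
def W : Submodule F (Fin 6 → E) where
  carrier := {v | ∃ a b : E, v = vec F a b}
  add_mem' := by
    rintro _ _ ⟨a, b, rfl⟩ ⟨a', b', rfl⟩
    exact ⟨_, _, vec_add F a b a' b'⟩
  zero_mem' := ⟨0, 0, by ext i; fin_cases i <;> simp [vec]⟩
  smul_mem' := by
    rintro r _ ⟨a, b, rfl⟩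
    exact ⟨_, _, vec_smul F r a b⟩

variable {E} in
/-- The vector `(a, a^q, a^(q^2), b^(q^2), b^q, b)` as an element of `W`. -/
def wvec (a b : E) : W F E := ⟨vec F a b, a, b, rfl⟩

variable {E} in
theorem wvec_ne_zero {a b : E} (h : a ≠ 0 ∨ b ≠ 0) : wvec F a b ≠ 0 := by
  intro h0
  have h1 : vec F a b = 0 := congrArg Subtype.val h0
  rcases h with h | h
  · exact h (by simpa [vec] using congrFun h1 0)
  · exact h (by simpa [vec] using congrFun h1 5)

variable {E} in
/-- The point `P_{a,b}` of `PG(W)`, for `(a, b)` not both zero. -/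
def point (a b : E) (h : a ≠ 0 ∨ b ≠ 0) : ℙ F (W F E) :=
  Projectivization.mk F (wvec F a b) (wvec_ne_zero F h)

/-- The alternating form
`x₀ y₅ + x₁ y₄ + x₂ y₃ - x₃ y₂ - x₄ y₁ - x₅ y₀` on `E^6`. -/
def beta : LinearMap.BilinForm E (Fin 6 → E) :=
  LinearMap.mk₂ E
    (fun x y => x 0 * y 5 + x 1 * y 4 + x 2 * y 3 - x 3 * y 2 - x 4 * y 1 - x 5 * y 0)
    (by intros; simp only [Pi.add_apply]; ring)
    (by intros; simp only [Pi.smul_apply, smul_eq_mul]; ring)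
    (by intros; simp only [Pi.add_apply]; ring)
    (by intros; simp only [Pi.smul_apply, smul_eq_mul]; ring)

/-- The restriction of `beta` to `W`, as an `F`-bilinear map with values in `E`. -/
def betaW : W F E →ₗ[F] W F E →ₗ[F] E :=
  LinearMap.mk₂ F (fun x y => beta E x y)
    (by intros; simp)
    (by
      intro r x y
      simp [beta, Algebra.smul_def]
      ring)
    (by intros; simp)
    (by
      intro r x y
      simp [beta, Algebra.smul_def]
      ring)

variable {E} in
/-- On `W` the form `beta` takes its values in `F`. -/
theorem betaW_mem_range (hE : Module.finrank F E = 3) (x y : W F E) :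
    betaW F E x y ∈ LinearMap.range (Algebra.linearMap F E) := by
  obtain ⟨_, a, b, rfl⟩ := x
  obtain ⟨_, a', b', rfl⟩ := y
  have : FiniteDimensional F E := Module.finite_of_finrank_pos (by omega)
  have : Finite E := Module.finite_of_finite F
  refine ⟨Algebra.trace F E (a * b') - Algebra.trace F E (b * a'), ?_⟩
  rw [map_sub]
  simp only [Algebra.linearMap_apply]
  rw [FiniteField.algebraMap_trace_eq_sum_pow, FiniteField.algebraMap_trace_eq_sum_pow, hE]
  simp [Finset.sum_range_succ, betaW, beta, vec, mul_pow]
  ring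

variable {E} in
/-- The `F`-valued form induced by `beta` on `W`; its polar space is `W(5,q)`. -/
def form (hE : Module.finrank F E = 3) : LinearMap.BilinForm F (W F E) :=
  LinearMap.codRestrict₂ (betaW F E) (Algebra.linearMap F E)
    (FaithfulSMul.algebraMap_injective F E) (betaW_mem_range F hE)

variable {E} in
theorem algebraMap_form (hE : Module.finrank F E = 3) (x y : W F E) :
    algebraMap F E (form F hE x y) = beta E x y :=
  LinearMap.codRestrict₂_apply (betaW F E) (Algebra.linearMap F E)
    (FaithfulSMul.algebraMap_injective F E) (betaW_mem_range F hE) x y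

variable {E} in
/-- The matrix `D_x = diag(x, x^q, x^(q^2), x^(-q^2), x^(-q), x^(-1))`. -/
def matD (x : Eˣ) : Matrix (Fin 6) (Fin 6) E :=
  Matrix.diagonal fun i => (![x, x ^ Fintype.card F, x ^ Fintype.card F ^ 2, (x ^ Fintype.card F ^ 2)⁻¹, (x ^ Fintype.card F)⁻¹, x⁻¹] i : Eˣ)

variable {E} in
set_option linter.unusedSectionVars false in
theorem matD_mulVec_vec (x : Eˣ) (a b : E) :
    (matD F x).mulVec (vec F a b) = vec F ((x : E) * a) ((x : E)⁻¹ * b) := by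
  ext i
  fin_cases i <;> simp [matD, Matrix.mulVec_diagonal, vec, mul_pow]

variable {E} in
/-- The `F`-linear endomorphism of `W` given by `D_x`. -/
def endD (x : Eˣ) : Module.End F (W F E) :=
  (((matD F x).mulVecLin).restrictScalars F).restrict (p := W F E) (q := W F E) (by
    rintro _ ⟨a, b, rfl⟩
    exact ⟨_, _, matD_mulVec_vec F x a b⟩)

variable {E} in
theorem endD_wvec (x : Eˣ) (a b : E) :
    endD F x (wvec F a b) = wvec F ((x : E) * a) ((x : E)⁻¹ * b) :=
  Subtype.ext (matD_mulVec_vec F x a b)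

/-- The group homomorphism `x ↦ D_x` into `GL(W)`. -/
def homD : Eˣ →* LinearMap.GeneralLinearGroup F (W F E) :=
  MonoidHom.toHomUnits
    { toFun := endD F
      map_one' := by
        refine LinearMap.ext ?_
        rintro ⟨_, a, b, rfl⟩
        refine (endD_wvec F 1 a b).trans ?_
        simp [wvec]
      map_mul' := by
        intro x y
        refine LinearMap.ext ?_
        rintro ⟨_, a, b, rfl⟩
        change endD F (x * y) (wvec F a b) = endD F x (endD F y (wvec F a b))
        rw [endD_wvec, endD_wvec, endD_wvec]
        congr 1
        · simp [mul_assoc]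
        · simp [mul_comm, mul_left_comm] }

/-- The elements `x` of `E` with `N(x) = x^(q^2+q+1) = 1`. -/
def normOne : Subgroup Eˣ :=
  (powMonoidHom (Fintype.card F ^ 2 + Fintype.card F + 1) : Eˣ →* Eˣ).ker

/-- The group `K` of the projectivities of `PG(W)` induced by the `D_x` with `N(x) = 1`. -/
def K : Subgroup (Equiv.Perm (ℙ F (W F E))) :=
  (normOne F E).map
    ((MulAction.toPermHom (LinearMap.GeneralLinearGroup F (W F E)) (ℙ F (W F E))).comp
      (homD F E))

variable {E} in
/-- The orbit of the point `P_{1,c}` under `K`, for `c` in `F`. -/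
def orbitO (c : F) : Set (ℙ F (W F E)) :=
  MulAction.orbit (K F E) (point F (1 : E) (algebraMap F E c) (Or.inl one_ne_zero))

end SymplecticOvoid

end

/-! The form on `W` is `Tr(ab') - Tr(ba')`. Two points of the orbit with parameters `x`, `y` are
orthogonal iff `z = x/y`, of norm one, satisfies `Tr z = Tr z⁻¹`. Since `N(1 - z) = 1 - Tr z + Tr
z⁻¹ - N(z)`, this forces `z = 1` (`eq_one_of_trace_eq_trace_inv`). Hence the orbit is a partial
ovoid and `K` acts freely on it.

Maximality amounts to showing that every `P_{a,b}` is orthogonal to some point of the orbit, that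
is, with `A = ca`, that `Tr(A x⁻¹) = Tr(b x)` has a solution of norm one (`exists_trace_eq`). By
Hilbert 90 one looks for `x = y^q / y`; clearing denominators gives a cubic form in `(y, y^q,
y^(q²))`, which in a basis of `E` over `F` is a ternary cubic over `F`. If it had no nontrivial
zero, it would be the norm of a linear form over `E`. The absent `x³` and `xyz` terms then make one
coefficient of this linear form vanish and the norms of the other two add up to zero, and Hilbert 90
produces a zero after all (`exists_cubicForm_cyclicCubic_eq_zero`).

The remaining ingredient is that an anisotropic ternary cubic `a` over a finite field is a norm form
(`IsAnisotropic.exists_eq_normForm`). If it is not, count the pairs `(c, m)` for which `a = N(m) - l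
c` with some linear form `l` over `F`, where `c` is a quadratic form over `F` and `m` a linear form
over `E`. Factoring the restriction of `a` to the conic `c` gives at least `3(q²+q+1)` forms `m`
when `c` is smooth, and at least `9(q²+q+1)` when `c` is a pair of distinct rational lines.
Conversely `l ≠ 0`, `c` is determined by `l` and `m`, and restriction to the line `l` leaves at most
`3(q²+q+1)q³` forms `m`. The two estimates contradict each other. -/

namespace TernaryCubic

/-! ### Ternary forms given by their coefficients -/

section Forms

variable {R S : Type*} [CommRing R] [CommRing S]

/-- The ternary linear form with coefficients `l`. -/
def linForm (l v : Fin 3 → R) : R := l 0 * v 0 + l 1 * v 1 + l 2 * v 2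

/-- The ternary quadratic form with coefficients `c`. -/
def quadForm (c : Fin 6 → R) (v : Fin 3 → R) : R :=
  c 0 * v 0 ^ 2 + c 1 * (v 0 * v 1) + c 2 * (v 0 * v 2) + c 3 * v 1 ^ 2 + c 4 * (v 1 * v 2) +
    c 5 * v 2 ^ 2

/-- The ternary cubic form with coefficients `a`. -/
def cubicForm (a : Fin 10 → R) (v : Fin 3 → R) : R :=
  a 0 * v 0 ^ 3 + a 1 * (v 0 ^ 2 * v 1) + a 2 * (v 0 ^ 2 * v 2) + a 3 * (v 0 * v 1 ^ 2) +
    a 4 * (v 0 * v 1 * v 2) + a 5 * (v 0 * v 2 ^ 2) + a 6 * v 1 ^ 3 + a 7 * (v 1 ^ 2 * v 2) +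
    a 8 * (v 1 * v 2 ^ 2) + a 9 * v 2 ^ 3

theorem map_quadForm (φ : R →+* S) (c : Fin 6 → R) (v : Fin 3 → R) :
    φ (quadForm c v) = quadForm (φ ∘ c) (φ ∘ v) := by
  simp [quadForm]

theorem map_cubicForm (φ : R →+* S) (a : Fin 10 → R) (v : Fin 3 → R) :
    φ (cubicForm a v) = cubicForm (φ ∘ a) (φ ∘ v) := by
  simp [cubicForm]

/-- The derivative of the ternary cubic form with coefficients `a` at `u` in direction `v`. -/
def cubicDeriv (a : Fin 10 → R) (u v : Fin 3 → R) : R :=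
  3 * a 0 * u 0 ^ 2 * v 0 + a 1 * (2 * u 0 * v 0 * u 1 + u 0 ^ 2 * v 1) +
    a 2 * (2 * u 0 * v 0 * u 2 + u 0 ^ 2 * v 2) + a 3 * (u 1 ^ 2 * v 0 + 2 * u 0 * u 1 * v 1) +
    a 4 * (u 0 * u 1 * v 2 + u 0 * v 1 * u 2 + v 0 * u 1 * u 2) +
    a 5 * (v 0 * u 2 ^ 2 + 2 * u 0 * u 2 * v 2) + 3 * a 6 * u 1 ^ 2 * v 1 +
    a 7 * (2 * u 1 * v 1 * u 2 + u 1 ^ 2 * v 2) + a 8 * (v 1 * u 2 ^ 2 + 2 * u 1 * u 2 * v 2) +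
    3 * a 9 * u 2 ^ 2 * v 2

theorem map_cubicDeriv (φ : R →+* S) (a : Fin 10 → R) (u v : Fin 3 → R) :
    φ (cubicDeriv a u v) = cubicDeriv (φ ∘ a) (φ ∘ u) (φ ∘ v) := by
  simp [cubicDeriv, map_ofNat]

/-- An expansion valid in every characteristic. `cubicDeriv a u v` is quadratic in `u` and linear in
`v`, so the coefficient of `xyz` is its polarization in the first argument; no division by 2 or 3
occurs. -/
theorem cubicForm_comb (a : Fin 10 → R) (x y z : R) (u v w : Fin 3 → R) :
    cubicForm a (x • u + y • v + z • w) =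
      x ^ 3 * cubicForm a u + x ^ 2 * y * cubicDeriv a u v + x ^ 2 * z * cubicDeriv a u w +
      x * y ^ 2 * cubicDeriv a v u +
      x * y * z * (cubicDeriv a (u + w) v - cubicDeriv a u v - cubicDeriv a w v) +
      x * z ^ 2 * cubicDeriv a w u + y ^ 3 * cubicForm a v + y ^ 2 * z * cubicDeriv a v w +
      y * z ^ 2 * cubicDeriv a w v + z ^ 3 * cubicForm a w := by
  simp only [cubicForm, cubicDeriv, Pi.add_apply, Pi.smul_apply, smul_eq_mul]
  ring

/-- The coefficients of the cubic form obtained by a linear substitution. -/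
def cubicSubst (a : Fin 10 → R) (G : Matrix (Fin 3) (Fin 3) R) : Fin 10 → R :=
  let u := G.col 0
  let v := G.col 1
  let w := G.col 2
  ![cubicForm a u, cubicDeriv a u v, cubicDeriv a u w, cubicDeriv a v u,
    cubicDeriv a (u + w) v - cubicDeriv a u v - cubicDeriv a w v, cubicDeriv a w u,
    cubicForm a v, cubicDeriv a v w, cubicDeriv a w v, cubicForm a w]

theorem mulVec_eq_comb (G : Matrix (Fin 3) (Fin 3) R) (v : Fin 3 → R) :
    G.mulVec v = v 0 • G.col 0 + v 1 • G.col 1 + v 2 • G.col 2 := by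
  ext i
  simp [Matrix.mulVec, dotProduct, Fin.sum_univ_three, mul_comm]

theorem cubicForm_cubicSubst (a : Fin 10 → R) (G : Matrix (Fin 3) (Fin 3) R) (v : Fin 3 → R) :
    cubicForm (cubicSubst a G) v = cubicForm a (G.mulVec v) := by
  rw [mulVec_eq_comb, cubicForm_comb]
  simp only [cubicForm, cubicSubst]
  simp
  ring

theorem map_cubicSubst (φ : R →+* S) (a : Fin 10 → R) (G : Matrix (Fin 3) (Fin 3) R) :
    φ ∘ cubicSubst a G = cubicSubst (φ ∘ a) (G.map φ) := by
  ext i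
  have h : φ ∘ (G.col 0 + G.col 2) = (G.map φ).col 0 + (G.map φ).col 2 := by
    ext i; simp
  fin_cases i <;> simp [cubicSubst, map_cubicForm, map_cubicDeriv, h] <;> rfl

theorem linForm_mulVec (l : Fin 3 → R) (G : Matrix (Fin 3) (Fin 3) R) (v : Fin 3 → R) :
    linForm l (G.mulVec v) = linForm (G.transpose.mulVec l) v := by
  simp [linForm, Matrix.mulVec, dotProduct, Fin.sum_univ_three]
  ring

theorem quadForm_smul (c : Fin 6 → R) (r : R) (v : Fin 3 → R) :
    quadForm c (r • v) = r ^ 2 * quadForm c v := by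
  simp [quadForm]; ring

/-- The polar form of a quadratic form. -/
def quadPolar (c : Fin 6 → R) (v w : Fin 3 → R) : R :=
  2 * c 0 * v 0 * w 0 + c 1 * (v 0 * w 1 + v 1 * w 0) + c 2 * (v 0 * w 2 + v 2 * w 0) +
    2 * c 3 * v 1 * w 1 + c 4 * (v 1 * w 2 + v 2 * w 1) + 2 * c 5 * v 2 * w 2

theorem map_quadPolar (φ : R →+* S) (c : Fin 6 → R) (v w : Fin 3 → R) :
    φ (quadPolar c v w) = quadPolar (φ ∘ c) (φ ∘ v) (φ ∘ w) := by
  simp [quadPolar, map_ofNat]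

theorem quadForm_comb (c : Fin 6 → R) (x y z : R) (u v w : Fin 3 → R) :
    quadForm c (x • u + y • v + z • w) =
      x ^ 2 * quadForm c u + y ^ 2 * quadForm c v + z ^ 2 * quadForm c w +
      x * y * quadPolar c u v + x * z * quadPolar c u w + y * z * quadPolar c v w := by
  simp only [quadForm, quadPolar, Pi.add_apply, Pi.smul_apply, smul_eq_mul]
  ring

/-- A cubic form over a field with more than two elements is determined by its values. -/
theorem cubicForm_eq_zero {K : Type*} [Field K] {t : K} (h0 : t ≠ 0) (h1 : t ≠ 1)
    {a : Fin 10 → K} (h : ∀ v, cubicForm a v = 0) : a = 0 := by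
  -- On each side of the coordinate triangle only two mixed monomials survive; the values at
  -- parameters `1` and `t` separate them, the determinant being `t (t - 1)`.
  have key : ∀ x y : K, x + y = 0 → t * x + t ^ 2 * y = 0 → x = 0 ∧ y = 0 := by
    intro x y hxy hxy'
    have h2 : (t * (t - 1)) * y = 0 := by linear_combination hxy' - t * hxy
    have hy : y = 0 := by simpa [h0, sub_ne_zero.2 h1] using h2
    exact ⟨by simpa [hy] using hxy, hy⟩
  have e (x y z : K) := h ![x, y, z]
  simp only [cubicForm, Matrix.cons_val] at e
  have a0 : a 0 = 0 := by linear_combination e 1 0 0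
  have a6 : a 6 = 0 := by linear_combination e 0 1 0
  have a9 : a 9 = 0 := by linear_combination e 0 0 1
  obtain ⟨a3, a1⟩ := key (a 3) (a 1) (by linear_combination e 1 1 0 - a0 - a6)
    (by linear_combination e t 1 0 - t ^ 3 * a0 - a6)
  obtain ⟨a5, a2⟩ := key (a 5) (a 2) (by linear_combination e 1 0 1 - a0 - a9)
    (by linear_combination e t 0 1 - t ^ 3 * a0 - a9)
  obtain ⟨a8, a7⟩ := key (a 8) (a 7) (by linear_combination e 0 1 1 - a6 - a9)
    (by linear_combination e 0 t 1 - t ^ 3 * a6 - a9)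
  have a4 : a 4 = 0 := by
    linear_combination e 1 1 1 - a0 - a1 - a2 - a3 - a5 - a6 - a7 - a8 - a9
  ext i
  fin_cases i <;> assumption

/-- The coefficients of the product of a linear and a quadratic form. -/
def mulCoeff (l : Fin 3 → R) (c : Fin 6 → R) : Fin 10 → R :=
  ![l 0 * c 0, l 0 * c 1 + l 1 * c 0, l 0 * c 2 + l 2 * c 0, l 0 * c 3 + l 1 * c 1,
    l 0 * c 4 + l 1 * c 2 + l 2 * c 1, l 0 * c 5 + l 2 * c 2, l 1 * c 3, l 1 * c 4 + l 2 * c 3,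
    l 1 * c 5 + l 2 * c 4, l 2 * c 5]

theorem cubicForm_mulCoeff (l : Fin 3 → R) (c : Fin 6 → R) (v : Fin 3 → R) :
    cubicForm (mulCoeff l c) v = linForm l v * quadForm c v := by
  simp [cubicForm, mulCoeff, linForm, quadForm]
  ring

theorem eq_zero_of_mulCoeff_eq_zero [IsDomain R] {l : Fin 3 → R} {c : Fin 6 → R} (hl : l ≠ 0)
    (h : mulCoeff l c = 0) : c = 0 := by
  have e (i) := congrFun h i
  have e0 := e 0
  have e1 := e 1
  have e2 := e 2
  have e3 := e 3
  have e4 := e 4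
  have e5 := e 5
  have e6 := e 6
  have e7 := e 7
  have e8 := e 8
  have e9 := e 9
  simp only [mulCoeff, Matrix.cons_val, Pi.zero_apply] at e0 e1 e2 e3 e4 e5 e6 e7 e8 e9
  suffices c 0 = 0 ∧ c 1 = 0 ∧ c 2 = 0 ∧ c 3 = 0 ∧ c 4 = 0 ∧ c 5 = 0 by
    obtain ⟨h0, h1, h2, h3, h4, h5⟩ := this
    ext i
    fin_cases i <;> assumption
  by_cases l0 : l 0 = 0
  · by_cases l1 : l 1 = 0
    · have l2 : l 2 ≠ 0 := by
        intro l2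
        apply hl
        ext i
        fin_cases i <;> assumption
      simp_all
    · simp_all
  · simp_all

end Forms

end TernaryCubic

namespace TernaryCubic

/-! ### The Frobenius automorphism of a cubic extension of finite fields -/

section Frobenius

variable (F : Type*) {E : Type*} [Field F] [Fintype F] [Field E] [Algebra F E]

/-- The Frobenius endomorphism `x ↦ x ^ |F|`. -/
def frob : E →ₐ[F] E := FiniteField.frobeniusAlgHom F E

theorem frob_apply (x : E) : frob F x = x ^ Fintype.card F := rfl

/-- The product of the three conjugates of an element of a cubic extension. -/
def conjProd (x : E) : E := x * frob F x * frob F (frob F x)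

theorem conjProd_mul (x y : E) : conjProd F (x * y) = conjProd F x * conjProd F y := by
  simp only [conjProd, map_mul]; ring

theorem conjProd_eq_zero {x : E} : conjProd F x = 0 ↔ x = 0 := by
  simp [conjProd]

theorem conjProd_eq_pow (x : E) :
    conjProd F x = x ^ (Fintype.card F ^ 2 + Fintype.card F + 1) := by
  simp only [conjProd, frob_apply]; ring

variable (hE : Module.finrank F E = 3)
include hE

theorem finite_of_finrank_eq_three : Finite E :=
  have : FiniteDimensional F E := Module.finite_of_finrank_pos (by omega)
  Module.finite_of_finite F

theorem natCard_eq : Nat.card E = Fintype.card F ^ 3 := by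
  have := finite_of_finrank_eq_three F hE
  have := Fintype.ofFinite E
  rw [Nat.card_eq_fintype_card, Module.card_eq_pow_finrank (K := F), hE]

theorem frob_frob_frob (x : E) : frob F (frob F (frob F x)) = x := by
  have := finite_of_finrank_eq_three F hE
  have := Fintype.ofFinite E
  have h := FiniteField.pow_card x
  rw [← Nat.card_eq_fintype_card, natCard_eq F hE] at h
  simp only [frob_apply]
  rw [← pow_mul, ← pow_mul]
  convert h using 2
  ring

theorem algebraMap_norm (x : E) : algebraMap F E (Algebra.norm F x) = conjProd F x := by
  have := finite_of_finrank_eq_three F hE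
  rw [FiniteField.algebraMap_norm_eq_prod_pow, hE]
  simp only [conjProd, frob_apply, Finset.prod_range_succ, Finset.prod_range_zero,
    Nat.card_eq_fintype_card]
  ring

/-- The Galois group is generated by Frobenius, so an element fixed by Frobenius is fixed by the
whole group. -/
theorem exists_algebraMap_eq {x : E} (h : frob F x = x) : ∃ y, algebraMap F E y = x := by
  have := finite_of_finrank_eq_three F hE
  have := (IsGalois.mem_range_algebraMap_iff_fixed (F := F) (E := E) x).2 (by
    intro g
    obtain ⟨n, rfl⟩ := (FiniteField.bijective_frobeniusAlgEquivOfAlgebraic_pow F E).2 g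
    rw [AlgEquiv.coe_pow]
    exact Function.iterate_fixed h _)
  simpa using this

/-- The norm is surjective on unit groups, so each fibre over a nonzero value has `(q³ - 1)/(q - 1)`
elements. -/
theorem natCard_conjProd_eq {k : F} (hk : k ≠ 0) :
    Nat.card {u : E // conjProd F u = algebraMap F E k} =
      Fintype.card F ^ 2 + Fintype.card F + 1 := by
  have := finite_of_finrank_eq_three F hE
  let f : Eˣ →* Fˣ := Units.map (Algebra.norm F (S := E))
  have hf : Function.Surjective f := FiniteField.unitsMap_norm_surjective F E
  have hq : 1 < Fintype.card F := Fintype.one_lt_card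
  have h1 : Nat.card f.ker = Fintype.card F ^ 2 + Fintype.card F + 1 := by
    have h := f.ker.card_mul_index
    rw [Subgroup.index_ker, MonoidHom.range_eq_top.2 hf, Subgroup.card_top, Nat.card_units,
      Nat.card_units, natCard_eq F hE, Nat.card_eq_fintype_card (α := F)] at h
    obtain ⟨r, hr⟩ : ∃ r, Fintype.card F = r + 1 := ⟨_, (Nat.sub_add_cancel hq.le).symm⟩
    rw [hr] at h hq ⊢
    have h2 : (r + 1) ^ 3 - 1 = ((r + 1) ^ 2 + (r + 1) + 1) * r := by
      rw [Nat.sub_eq_iff_eq_add (Nat.one_le_pow _ _ (by omega))]; ring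
    rw [h2, Nat.add_sub_cancel] at h
    exact Nat.eq_of_mul_eq_mul_right (by omega) h
  rw [← h1, ← Nat.card_congr (MonoidHom.fiberEquivKerOfSurjective hf (Units.mk0 k hk))]
  symm
  refine Nat.card_congr (Equiv.ofBijective
    (fun u => ⟨(u : Eˣ), ?_⟩) ⟨?_, ?_⟩)
  · have hu : f (u : Eˣ) = Units.mk0 k hk := u.2
    rw [← algebraMap_norm F hE]
    exact congrArg (fun z : Fˣ => algebraMap F E z) hu
  · intro u v huv
    exact Subtype.ext (Units.ext (congrArg Subtype.val huv))
  · rintro ⟨u, hu⟩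
    have h0 : u ≠ 0 := by
      rintro rfl
      rw [(conjProd_eq_zero F).2 rfl] at hu
      exact hk ((map_eq_zero _).1 hu.symm)
    refine ⟨⟨Units.mk0 u h0, ?_⟩, rfl⟩
    rw [← algebraMap_norm F hE] at hu
    exact Units.ext ((algebraMap F E).injective hu)

/-- Hilbert's theorem 90 for a cubic extension of finite fields. -/
theorem exists_frob_eq_mul {x : E} (h : conjProd F x = 1) : ∃ y : E, y ≠ 0 ∧ frob F y = x * y := by
  have := finite_of_finrank_eq_three F hE
  have hx : x ≠ 0 := by
    rintro rfl
    rw [(conjProd_eq_zero F).2 rfl] at h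
    exact zero_ne_one h
  have hq : 1 < Fintype.card F := Fintype.one_lt_card
  obtain ⟨g, hg⟩ := IsCyclic.exists_generator (α := Eˣ)
  obtain ⟨n, hn⟩ := mem_powers_iff_mem_zpowers.2 (hg (Units.mk0 x hx))
  have hn' : g ^ n = Units.mk0 x hx := hn
  have h1 : g ^ (n * (Fintype.card F ^ 2 + Fintype.card F + 1)) = 1 := by
    rw [pow_mul, hn']
    ext
    simpa [conjProd_eq_pow] using h
  have h2 := orderOf_dvd_of_pow_eq_one h1
  rw [orderOf_eq_card_of_forall_mem_zpowers hg, Nat.card_units, natCard_eq F hE] at h2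
  obtain ⟨r, hr⟩ : ∃ r, Fintype.card F = r + 1 := ⟨_, (Nat.sub_add_cancel hq.le).symm⟩
  have h3 : Fintype.card F ^ 3 - 1 = r * (Fintype.card F ^ 2 + Fintype.card F + 1) := by
    rw [hr, Nat.sub_eq_iff_eq_add (Nat.one_le_pow _ _ (by omega))]; ring
  rw [h3] at h2
  -- With `x = g ^ n`, the order `(q - 1)(q² + q + 1)` of `g` divides `n (q² + q + 1)`. So `q - 1`
  -- divides `n`, and `y = g ^ (n / (q - 1))` satisfies `y ^ (q - 1) = x`.
  obtain ⟨k, rfl⟩ := Nat.dvd_of_mul_dvd_mul_right (by positivity) h2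
  refine ⟨((g ^ k : Eˣ) : E), Units.ne_zero _, ?_⟩
  have h4 : x = ((g ^ (r * k) : Eˣ) : E) := by rw [hn']; rfl
  rw [h4, frob_apply, hr]
  push_cast
  ring

/-- A cubic extension has an element different from `0` and `1`. -/
theorem exists_ne_zero_ne_one : ∃ t : E, t ≠ 0 ∧ t ≠ 1 := by
  have := finite_of_finrank_eq_three F hE
  by_contra! h
  have hq : 1 < Fintype.card F := Fintype.one_lt_card
  have h1 : Nat.card E ≤ 2 := by
    rw [← Set.ncard_univ]
    refine (Set.ncard_le_ncard (t := {0, 1}) ?_ (Set.toFinite _)).trans (Set.ncard_insert_le _ _ |>.trans (by simp))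
    intro t _
    by_cases ht : t = 0
    · simp [ht]
    · simp [h t ht]
  rw [natCard_eq F hE] at h1
  have : 2 ^ 3 ≤ Fintype.card F ^ 3 := Nat.pow_le_pow_left hq 3
  omega

end Frobenius

/-! ### Norm forms -/

section NormForm

variable (F : Type*) {E : Type*} [Field F] [Fintype F] [Field E] [Algebra F E]

/-- The product of a linear form over a cubic extension and its conjugates. -/
def normForm (l v : Fin 3 → E) : E :=
  linForm l v * linForm (frob F ∘ l) v * linForm (frob F ∘ frob F ∘ l) v

/-- The coefficients of a product of three linear forms. -/
def prodCoeff {R : Type*} [CommRing R] (l m n : Fin 3 → R) : Fin 10 → R :=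
  mulCoeff l ![m 0 * n 0, m 0 * n 1 + m 1 * n 0, m 0 * n 2 + m 2 * n 0, m 1 * n 1,
    m 1 * n 2 + m 2 * n 1, m 2 * n 2]

theorem cubicForm_prodCoeff {R : Type*} [CommRing R] (l m n v : Fin 3 → R) :
    cubicForm (prodCoeff l m n) v = linForm l v * linForm m v * linForm n v := by
  simp [prodCoeff, cubicForm_mulCoeff, quadForm, linForm]
  ring

theorem prodCoeff_rotate {R : Type*} [CommRing R] (l m n : Fin 3 → R) :
    prodCoeff l m n = prodCoeff m n l := by
  ext i
  fin_cases i <;> simp [prodCoeff, mulCoeff] <;> ring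

theorem map_prodCoeff {R S : Type*} [CommRing R] [CommRing S] (φ : R →+* S) (l m n : Fin 3 → R) :
    φ ∘ prodCoeff l m n = prodCoeff (φ ∘ l) (φ ∘ m) (φ ∘ n) := by
  ext i
  fin_cases i <;> simp [prodCoeff, mulCoeff]

theorem normForm_mulVec (l : Fin 3 → E) (G : Matrix (Fin 3) (Fin 3) F) (v : Fin 3 → E) :
    normForm F l ((G.map (algebraMap F E)).mulVec v) =
      normForm F ((G.map (algebraMap F E)).transpose.mulVec l) v := by
  have h (l : Fin 3 → E) : frob F ∘ ((G.map (algebraMap F E)).transpose.mulVec l) =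
      (G.map (algebraMap F E)).transpose.mulVec (frob F ∘ l) := by
    ext i
    simp [Matrix.mulVec, dotProduct]
  simp only [normForm, linForm_mulVec, h]

theorem normForm_smul (u : E) (l v : Fin 3 → E) :
    normForm F (u • l) v = conjProd F u * normForm F l v := by
  simp [normForm, linForm, conjProd]
  ring

theorem cubicForm_prodCoeff_frob (l v : Fin 3 → E) :
    cubicForm (prodCoeff l (frob F ∘ l) (frob F ∘ frob F ∘ l)) v = normForm F l v :=
  cubicForm_prodCoeff _ _ _ _

variable (hE : Module.finrank F E = 3)
include hE

theorem normForm_frob (l v : Fin 3 → E) : normForm F (frob F ∘ l) v = normForm F l v := by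
  have : frob F ∘ frob F ∘ frob F ∘ l = l := by
    ext i; exact frob_frob_frob F hE _
  simp only [normForm, this]
  ring

/-- Frobenius permutes the three factors cyclically, hence fixes every coefficient of the product.
-/
theorem exists_algebraMap_comp_eq_prodCoeff (l : Fin 3 → E) :
    ∃ n : Fin 10 → F,
      algebraMap F E ∘ n = prodCoeff l (frob F ∘ l) (frob F ∘ frob F ∘ l) := by
  have h3 : frob F ∘ frob F ∘ frob F ∘ l = l := by
    ext i; exact frob_frob_frob F hE _
  have h (i) : ∃ n : F, algebraMap F E n = prodCoeff l (frob F ∘ l) (frob F ∘ frob F ∘ l) i := by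
    apply exists_algebraMap_eq F hE
    have := map_prodCoeff (frob F : E →ₐ[F] E).toRingHom l (frob F ∘ l) (frob F ∘ frob F ∘ l)
    have := congrFun this i
    refine this.trans ?_
    change prodCoeff (frob F ∘ l) (frob F ∘ frob F ∘ l) (frob F ∘ frob F ∘ frob F ∘ l) i = _
    rw [h3, prodCoeff_rotate l]
  choose n hn using h
  exact ⟨n, funext hn⟩

end NormForm

end TernaryCubic

namespace TernaryCubic

/-! ### Factorization over a cubic extension -/

section Factorization

open Polynomial

variable (F : Type*) {E : Type*} [Field F] [Fintype F] [Field E] [Algebra F E]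

/-- The product of the three conjugates of a polynomial. -/
noncomputable def polyConjProd (m : E[X]) : E[X] :=
  m * m.map (frob F : E →ₐ[F] E).toRingHom *
    (m.map (frob F : E →ₐ[F] E).toRingHom).map (frob F : E →ₐ[F] E).toRingHom

theorem polyConjProd_mul (m n : E[X]) :
    polyConjProd F (m * n) = polyConjProd F m * polyConjProd F n := by
  simp only [polyConjProd, Polynomial.map_mul]; ring

variable {F} in
theorem monic_polyConjProd {m : E[X]} (hm : m.Monic) : (polyConjProd F m).Monic :=
  (hm.mul (hm.map _)).mul ((hm.map _).map _)

variable {F} in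
theorem natDegree_polyConjProd {m : E[X]} (hm : m.Monic) :
    (polyConjProd F m).natDegree = 3 * m.natDegree := by
  rw [polyConjProd, Monic.natDegree_mul (hm.mul (hm.map _)) ((hm.map _).map _),
    Monic.natDegree_mul hm (hm.map _), (hm.map _).natDegree_map, hm.natDegree_map]
  ring

variable {F}
variable (hE : Module.finrank F E = 3)
include hE

theorem exists_map_eq_polyConjProd (m : E[X]) :
    ∃ n : F[X], n.map (algebraMap F E) = polyConjProd F m := by
  have h : polyConjProd F m ∈ Polynomial.lifts (algebraMap F E) := by
    rw [Polynomial.lifts_iff_coeff_lifts]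
    intro i
    apply exists_algebraMap_eq F hE
    have h3 : ((m.map (frob F : E →ₐ[F] E).toRingHom).map (frob F : E →ₐ[F] E).toRingHom).map
        (frob F : E →ₐ[F] E).toRingHom = m := by
      ext i
      simpa using frob_frob_frob F hE _
    have h4 : (polyConjProd F m).map (frob F : E →ₐ[F] E).toRingHom = polyConjProd F m := by
      simp only [polyConjProd, Polynomial.map_mul, h3]
      ring
    conv_rhs => rw [← h4]
    simp
  exact (Polynomial.mem_lifts _).1 h

/-- The product of the conjugates of `m` descends to `F` and vanishes at `x`, so the minimal
polynomial `p` of `x` divides it; the degree bound leaves only equality of monic polynomials. -/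
theorem map_eq_polyConjProd {K : Type*} [Field K] [Algebra F K] [Algebra E K] [IsScalarTower F E K]
    {p : F[X]} (hp : Irreducible p) (hpm : p.Monic) {m : E[X]} (hm : m.Monic)
    (hd : 3 * m.natDegree ≤ p.natDegree) {x : K} (hx : aeval x m = 0) (hx' : aeval x p = 0) :
    p.map (algebraMap F E) = polyConjProd F m := by
  obtain ⟨n, hn⟩ := exists_map_eq_polyConjProd hE m
  have hnm : n.Monic := by
    have := monic_polyConjProd (F := F) hm
    rw [← hn] at this
    exact Polynomial.monic_of_injective (algebraMap F E).injective this
  have hnx : aeval x n = 0 := by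
    rw [← aeval_map_algebraMap E, hn]
    simp [polyConjProd, hx]
  have hpn : p ∣ n := by
    rw [minpoly.eq_of_irreducible_of_monic hp hx' hpm]
    exact minpoly.dvd F x hnx
  have hdn : n.natDegree = 3 * m.natDegree := by
    rw [← natDegree_polyConjProd (F := F) hm, ← hn, natDegree_map]
  rw [← hn, Polynomial.eq_of_monic_of_dvd_of_natDegree_le hpm hnm hpn (by omega)]

theorem exists_eq_polyConjProd_of_irreducible_three {p : F[X]} (hp : Irreducible p)
    (hpm : p.Monic) (h3 : p.natDegree = 3) :
    ∃ α : E, p.map (algebraMap F E) = polyConjProd F (X - C α) := by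
  have := finite_of_finrank_eq_three F hE
  have : Fact (Irreducible p) := ⟨hp⟩
  obtain ⟨i⟩ := FiniteField.nonempty_algHom_of_finrank_dvd (F := F) (K := AdjoinRoot p) (L := E)
    (by rw [show Module.finrank F (AdjoinRoot p) = _ from finrank_quotient_span_eq_natDegree, h3, hE])
  refine ⟨i (AdjoinRoot.root p), map_eq_polyConjProd hE (K := E) hp hpm (monic_X_sub_C _)
    (by simp [h3]) (x := i (AdjoinRoot.root p)) (by simp) ?_⟩
  rw [aeval_algHom_apply, AdjoinRoot.aeval_eq, AdjoinRoot.mk_self, map_zero]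

/-- Adjoining a root of `p` gives the extension of degree 6, which contains a copy of `E`. The
minimal polynomial of the root over `E` is the required quadratic factor. -/
theorem exists_eq_polyConjProd_of_irreducible_six {p : F[X]} (hp : Irreducible p)
    (hpm : p.Monic) (h6 : p.natDegree = 6) :
    ∃ m : E[X], m.Monic ∧ m.natDegree = 2 ∧ p.map (algebraMap F E) = polyConjProd F m := by
  have := finite_of_finrank_eq_three F hE
  have : Fact (Irreducible p) := ⟨hp⟩
  have hK : Module.finrank F (AdjoinRoot p) = 6 := by
    rw [show Module.finrank F (AdjoinRoot p) = _ from finrank_quotient_span_eq_natDegree, h6]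
  have : FiniteDimensional F (AdjoinRoot p) := Module.finite_of_finrank_pos (by omega)
  have : Finite (AdjoinRoot p) := Module.finite_of_finite F
  obtain ⟨i⟩ := FiniteField.nonempty_algHom_of_finrank_dvd (F := F) (K := E) (L := AdjoinRoot p)
    (by rw [hK, hE]; norm_num)
  let _ : Algebra E (AdjoinRoot p) := i.toRingHom.toAlgebra
  have : IsScalarTower F E (AdjoinRoot p) := IsScalarTower.of_algebraMap_eq (fun x => (i.commutes x).symm)
  have : FiniteDimensional E (AdjoinRoot p) := Module.Finite.of_restrictScalars_finite F _ _
  have hEK : Module.finrank E (AdjoinRoot p) = 2 := by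
    have := Module.finrank_mul_finrank F E (AdjoinRoot p)
    rw [hE, hK] at this
    omega
  set x := AdjoinRoot.root p
  have hint : IsIntegral E x := IsIntegral.of_finite E x
  have hdeg := minpoly.natDegree_le (A := E) x
  rw [hEK] at hdeg
  have key := map_eq_polyConjProd hE (K := AdjoinRoot p) hp hpm (minpoly.monic hint) (by omega)
    (x := x) (minpoly.aeval E x) (by rw [AdjoinRoot.aeval_eq, AdjoinRoot.mk_self])
  refine ⟨_, minpoly.monic hint, ?_, key⟩
  have := congrArg natDegree key
  rw [natDegree_polyConjProd (minpoly.monic hint), natDegree_map, h6] at this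
  omega

/-- A cubic polynomial without linear factors over the base field is a product of three conjugate
linear factors over a cubic extension. -/
theorem exists_eq_polyConjProd_three {p : F[X]} (hpm : p.Monic) (h3 : p.natDegree = 3)
    (h : ∀ x, p.eval x ≠ 0) :
    ∃ α : E, frob F α ≠ α ∧ p.map (algebraMap F E) = polyConjProd F (X - C α) := by
  have hp : Irreducible p := by
    rw [hpm.irreducible_iff_roots_eq_zero_of_degree_le_three (by omega) (by omega)]
    refine Multiset.eq_zero_of_forall_notMem fun x hx => h x ?_
    exact (mem_roots'.1 hx).2
  obtain ⟨α, hα⟩ := exists_eq_polyConjProd_of_irreducible_three hE hp hpm h3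
  refine ⟨α, fun h' => ?_, hα⟩
  obtain ⟨y, rfl⟩ := exists_algebraMap_eq F hE h'
  apply h y
  apply (algebraMap F E).injective
  rw [map_zero, ← eval_map_apply, hα]
  simp [polyConjProd]

/-- A sextic polynomial without factors of degree one and two over the base field is a product of
three conjugate quadratic factors over a cubic extension. -/
theorem exists_eq_polyConjProd_six {p : F[X]} (hpm : p.Monic) (h6 : p.natDegree = 6)
    (h1 : ∀ r : F[X], r.Monic → r.natDegree = 1 → ¬ r ∣ p)
    (h2 : ∀ r : F[X], r.Monic → r.natDegree = 2 → ¬ r ∣ p) :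
    ∃ m : E[X], m.Monic ∧ m.natDegree = 2 ∧ m.map (frob F : E →ₐ[F] E).toRingHom ≠ m ∧
      p.map (algebraMap F E) = polyConjProd F m := by
  suffices ∃ m : E[X], m.Monic ∧ m.natDegree = 2 ∧
      p.map (algebraMap F E) = polyConjProd F m by
    obtain ⟨m, hm, hm2, hpm⟩ := this
    refine ⟨m, hm, hm2, fun hf => ?_, hpm⟩
    -- A Frobenius-invariant `m` would come from a quadratic `r` over `F` with `p = r ^ 3`, contrary
    -- to `h2`.
    have h : m ∈ Polynomial.lifts (algebraMap F E) := by
      rw [Polynomial.lifts_iff_coeff_lifts]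
      intro i
      apply exists_algebraMap_eq F hE
      conv_rhs => rw [← hf]
      simp
    obtain ⟨r, rfl⟩ := (Polynomial.mem_lifts _).1 h
    have hr := Polynomial.monic_of_injective (algebraMap F E).injective hm
    apply h2 r hr (by rwa [natDegree_map] at hm2)
    have h' : p = r ^ 3 := by
      apply Polynomial.map_injective _ (algebraMap F E).injective
      rw [hpm, polyConjProd, hf, hf, Polynomial.map_pow]
      ring
    rw [h']
    exact dvd_pow_self r (by norm_num)
  obtain ⟨r, hrm, hr, hrp⟩ := Polynomial.exists_monic_irreducible_factor p
    (Polynomial.not_isUnit_of_natDegree_pos p (by omega))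
  obtain ⟨s, rfl⟩ := hrp
  have hsm : s.Monic := hrm.of_mul_monic_left hpm
  have hd := hrm.natDegree_mul hsm
  rw [h6] at hd
  have hr0 := hr.natDegree_pos
  have hr1 : r.natDegree ≠ 1 := fun h => h1 r hrm h ⟨s, rfl⟩
  have hr2 : r.natDegree ≠ 2 := fun h => h2 r hrm h ⟨s, rfl⟩
  have hs1 : s.natDegree ≠ 1 := fun h => h1 s hsm h ⟨r, mul_comm _ _⟩
  have hs2 : s.natDegree ≠ 2 := fun h => h2 s hsm h ⟨r, mul_comm _ _⟩
  -- Neither `r` nor its cofactor has degree 1 or 2. If both are cubics, one linear factor over `E`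
  -- is taken from each, and their product is the quadratic `m`.
  obtain hr3 | hr6 : r.natDegree = 3 ∨ r.natDegree = 6 := by omega
  · have hroot (t : F[X]) (ht : t ∣ r * s) (x : F) : t.eval x ≠ 0 := fun h0 =>
      h1 (X - C x) (monic_X_sub_C x) (natDegree_X_sub_C x) ((dvd_iff_isRoot.2 h0).trans ht)
    obtain ⟨α, -, hα⟩ := exists_eq_polyConjProd_three hE hrm hr3 (hroot r ⟨s, rfl⟩)
    obtain ⟨β, -, hβ⟩ := exists_eq_polyConjProd_three hE hsm (by omega)
      (hroot s ⟨r, mul_comm _ _⟩)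
    refine ⟨(X - C α) * (X - C β), (monic_X_sub_C α).mul (monic_X_sub_C β), ?_, ?_⟩
    · rw [(monic_X_sub_C α).natDegree_mul (monic_X_sub_C β)]
      simp
    · rw [Polynomial.map_mul, hα, hβ, polyConjProd_mul]
  · have : s = 1 := hsm.natDegree_eq_zero.1 (by omega)
    subst this
    rw [mul_one]
    exact exists_eq_polyConjProd_of_irreducible_six hE hr hrm hr6

end Factorization

end TernaryCubic

namespace TernaryCubic

/-! ### Anisotropic cubics modulo a conic in normal form -/

section NormalForms

open Polynomial

/-- `(X² : X : 1)` parametrizes the conic `xz = y²`. The merged coefficients show that cubics with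
the same restriction differ by a multiple of `xz - y²`. -/
theorem cubicForm_parabola {R : Type*} [CommRing R] (a : Fin 10 → R) :
    cubicForm (C ∘ a) ![X ^ 2, X, 1] =
      C (a 0) * X ^ 6 + C (a 1) * X ^ 5 + C (a 2 + a 3) * X ^ 4 + C (a 4 + a 6) * X ^ 3 +
        C (a 5 + a 7) * X ^ 2 + C (a 8) * X + C (a 9) := by
  simp [cubicForm]
  ring

theorem cubicForm_line {R : Type*} [CommRing R] (a : Fin 10 → R) :
    cubicForm (C ∘ a) ![0, X, 1] =
      C (a 6) * X ^ 3 + C (a 7) * X ^ 2 + C (a 8) * X + C (a 9) := by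
  simp [cubicForm]

theorem cubicForm_line' {R : Type*} [CommRing R] (a : Fin 10 → R) :
    cubicForm (C ∘ a) ![1, X, 0] =
      C (a 6) * X ^ 3 + C (a 3) * X ^ 2 + C (a 1) * X + C (a 0) := by
  simp [cubicForm]
  ring

theorem eval_cubicForm {R : Type*} [CommRing R] (a : Fin 10 → R) (w : Fin 3 → R[X]) (x : R) :
    (cubicForm (C ∘ a) w).eval x = cubicForm a (fun i => (w i).eval x) := by
  simp [cubicForm]

theorem sub_dvd_cubicForm_sub {R : Type*} [CommRing R] (a : Fin 10 → R) (x x' y z : R) :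
    x - x' ∣ cubicForm a ![x, y, z] - cubicForm a ![x', y, z] := by
  refine ⟨a 0 * (x ^ 2 + x * x' + x' ^ 2) + a 1 * y * (x + x') + a 2 * z * (x + x') +
    a 3 * y ^ 2 + a 4 * y * z + a 5 * z ^ 2, ?_⟩
  simp [cubicForm]
  ring

/-- A cubic form without nontrivial zeros. -/
def IsAnisotropic {F : Type*} [Field F] (a : Fin 10 → F) : Prop :=
  ∀ v, v ≠ 0 → cubicForm a v ≠ 0

variable {F E : Type*} [Field F] [Fintype F] [Field E] [Algebra F E]

omit [Fintype F] in
theorem IsAnisotropic.apply_zero_ne {a : Fin 10 → F} (ha : IsAnisotropic a) : a 0 ≠ 0 := by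
  have := ha ![1, 0, 0] (fun h => one_ne_zero (congrFun h 0))
  simpa [cubicForm] using this

omit [Fintype F] in
theorem IsAnisotropic.apply_six_ne {a : Fin 10 → F} (ha : IsAnisotropic a) : a 6 ≠ 0 := by
  have := ha ![0, 1, 0] (fun h => one_ne_zero (congrFun h 1))
  simpa [cubicForm] using this

-- Modulo `r = X² + sX + t` the point `(X², X, 1)` becomes `(-sX - t, X, 1)`, which runs over the
-- line `x + sy + tz = 0`. There the cubic has degree exactly 3, because `(-s, 1, 0)` is not a zero.
-- If `r` divided it, the quotient would be linear, and its root would give a zero over `F`.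
omit [Fintype F] in
theorem IsAnisotropic.not_dvd_of_natDegree_eq_two {a : Fin 10 → F} (ha : IsAnisotropic a)
    {r : F[X]} (hr : r.Monic) (h2 : r.natDegree = 2) :
    ¬ r ∣ cubicForm (C ∘ a) ![X ^ 2, X, 1] := by
  intro h
  have hr' : r = X ^ 2 + C (r.coeff 1) * X + C (r.coeff 0) := by
    have := hr.as_sum
    rw [h2] at this
    simp only [Finset.sum_range_succ, Finset.sum_range_zero] at this
    rw [this]
    simp
    ring
  set s := r.coeff 1
  set t := r.coeff 0
  have h' : r ∣ cubicForm (C ∘ a) ![-(C s * X + C t), X, 1] := by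
    have h3 := sub_dvd_cubicForm_sub (C ∘ a) (X ^ 2) (-(C s * X + C t)) X 1
    rw [show X ^ 2 - -(C s * X + C t) = r by rw [hr']; ring] at h3
    exact (dvd_sub_right h).1 h3
  obtain ⟨k, hk⟩ := h'
  have hexp : cubicForm (C ∘ a) ![-(C s * X + C t), X, 1] =
      C (cubicForm a ![-s, 1, 0]) * X ^ 3 + C (cubicDeriv a ![-s, 1, 0] ![-t, 0, 1]) * X ^ 2 +
        C (cubicDeriv a ![-t, 0, 1] ![-s, 1, 0]) * X + C (cubicForm a ![-t, 0, 1]) := by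
    simp [cubicForm, cubicDeriv, map_ofNat]
    ring
  have hne : cubicForm a ![-s, 1, 0] ≠ 0 := ha _ (fun h => one_ne_zero (congrFun h 1))
  have hdeg : (cubicForm (C ∘ a) ![-(C s * X + C t), X, 1]).natDegree = 3 := by
    rw [hexp, natDegree_cubic hne]
  have hk0 : k ≠ 0 := by
    rintro rfl
    rw [hk] at hdeg
    simp at hdeg
  have hk1 : k.natDegree = 1 := by
    rw [hk, natDegree_mul hr.ne_zero hk0, h2] at hdeg
    omega
  obtain ⟨x, hx⟩ := exists_root_of_degree_eq_one
    (by rw [degree_eq_natDegree hk0, hk1]; rfl)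
  have hz : (cubicForm (C ∘ a) ![-(C s * X + C t), X, 1]).eval x = 0 := by
    rw [hk, eval_mul, hx.eq_zero, mul_zero]
  rw [eval_cubicForm] at hz
  exact ha _ (fun h => by simpa using congrFun h 2) hz

theorem map_cubicForm_eq_polyConjProd {l : Fin 3 → E} {n : Fin 10 → F}
    (hn : algebraMap F E ∘ n = prodCoeff l (frob F ∘ l) (frob F ∘ frob F ∘ l))
    (w : Fin 3 → F[X]) :
    (cubicForm (C ∘ n) w).map (algebraMap F E) =
      polyConjProd F (linForm (C ∘ l) (fun i => (w i).map (algebraMap F E))) := by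
  have h1 := map_cubicForm (mapRingHom (algebraMap F E)) (C ∘ n) w
  have h2 : mapRingHom (algebraMap F E) ∘ C ∘ n = C ∘ (algebraMap F E ∘ n) := by
    ext i : 1; simp
  have h3 (x : F[X]) : (x.map (algebraMap F E)).map (frob F : E →ₐ[F] E).toRingHom =
      x.map (algebraMap F E) := by
    rw [Polynomial.map_map]
    congr 1
    ext y
    simp
  rw [coe_mapRingHom] at h1
  rw [h1, ← coe_mapRingHom, h2, hn, map_prodCoeff, cubicForm_prodCoeff, polyConjProd]
  have h4 (k : Fin 3 → E) : linForm (C ∘ frob F ∘ k) (mapRingHom (algebraMap F E) ∘ w) =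
      (linForm (C ∘ k) (mapRingHom (algebraMap F E) ∘ w)).map (frob F : E →ₐ[F] E).toRingHom := by
    simp only [linForm, Polynomial.map_add, Polynomial.map_mul, Function.comp_apply, map_C,
      coe_mapRingHom, h3]
    simp
  rw [h4, h4, h4]
  rfl

/-- The cubic form `a` is the difference of the norm form of `m` and the product of the linear form
`l` and the quadratic form `c`. -/
def IsDecomp (a : Fin 10 → F) (c : Fin 6 → F) (l : Fin 3 → F) (m : Fin 3 → E) : Prop :=
  ∀ v : Fin 3 → E, cubicForm (algebraMap F E ∘ a) v =
    normForm F m v - linForm (algebraMap F E ∘ l) v * quadForm (algebraMap F E ∘ c) v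

omit [Fintype F] in
theorem cubicForm_sub_eq {k : F} {a n : Fin 10 → F} {c : Fin 6 → F} {l : Fin 3 → F}
    (h : mulCoeff l c = k • n - a) (v : Fin 3 → E) :
    cubicForm (algebraMap F E ∘ a) v = algebraMap F E k * cubicForm (algebraMap F E ∘ n) v -
      linForm (algebraMap F E ∘ l) v * quadForm (algebraMap F E ∘ c) v := by
  have h1 : mulCoeff (algebraMap F E ∘ l) (algebraMap F E ∘ c) =
      algebraMap F E ∘ mulCoeff l c := by
    ext i
    fin_cases i <;> simp [mulCoeff]
  rw [← cubicForm_mulCoeff, h1, h]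
  simp [cubicForm]
  ring

theorem isDecomp_of_mulCoeff_eq {k : F} {a n : Fin 10 → F} {c : Fin 6 → F} {l : Fin 3 → F}
    (h : mulCoeff l c = k • n - a) {m : Fin 3 → E}
    (hn : algebraMap F E ∘ n = prodCoeff m (frob F ∘ m) (frob F ∘ frob F ∘ m))
    {u : E} (hu : conjProd F u = algebraMap F E k) : IsDecomp a c l (u • m) := by
  intro v
  rw [cubicForm_sub_eq h, normForm_smul, hu, hn, cubicForm_prodCoeff_frob]

theorem frob_comp_vec (x y z : E) : frob F ∘ ![x, y, z] = ![frob F x, frob F y, frob F z] := by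
  ext i; fin_cases i <;> rfl

theorem linForm_C_vec (x y z : E) (w : Fin 3 → E[X]) :
    linForm (C ∘ ![x, y, z]) w = C x * w 0 + C y * w 1 + C z * w 2 := rfl

variable (hE : Module.finrank F E = 3)
include hE

theorem IsDecomp.frob {a : Fin 10 → F} {c : Fin 6 → F} {l : Fin 3 → F} {m : Fin 3 → E} {u : E}
    (h : IsDecomp a c l (u • m)) : IsDecomp a c l (u • (frob F ∘ m)) := by
  intro v
  rw [h, normForm_smul, normForm_smul, normForm_frob F hE]

/-- Restricted to `xz = y²` the cubic becomes a sextic without factors of degree 1 or 2, so it is `a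
0` times the product of the conjugates of some `X² + sX + t`. This quadratic is the restriction of
the line `x + sy + tz`, so `a` and `a 0` times the norm of that line agree on the conic and differ
by a multiple of its equation. -/
theorem IsAnisotropic.exists_isDecomp_parabola {a : Fin 10 → F} (ha : IsAnisotropic a) :
    ∃ s t : E, ¬ (TernaryCubic.frob F s = s ∧ TernaryCubic.frob F t = t) ∧ ∃ l : Fin 3 → F,
      ∀ u : E, conjProd F u = algebraMap F E (a 0) →
        IsDecomp a ![0, 0, 1, -1, 0, 0] l (u • ![1, s, t]) := by
  have h0 := ha.apply_zero_ne
  have hdvd {r : F[X]} : r ∣ C (a 0)⁻¹ * cubicForm (C ∘ a) ![X ^ 2, X, 1] ↔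
      r ∣ cubicForm (C ∘ a) ![X ^ 2, X, 1] :=
    (isUnit_C.2 (isUnit_iff_ne_zero.2 (inv_ne_zero h0))).dvd_mul_left
  have hdeg : (cubicForm (C ∘ a) ![X ^ 2, X, 1]).natDegree = 6 := by
    rw [cubicForm_parabola]
    compute_degree!
  have hlead : (cubicForm (C ∘ a) ![X ^ 2, X, 1]).leadingCoeff = a 0 := by
    rw [leadingCoeff, hdeg, cubicForm_parabola]
    simp [coeff_X_pow, -map_add]
  obtain ⟨m, hm, hm2, hmf, hp⟩ := exists_eq_polyConjProd_six hE
    (p := C (a 0)⁻¹ * cubicForm (C ∘ a) ![X ^ 2, X, 1])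
    (monic_C_mul_of_mul_leadingCoeff_eq_one (by rw [hlead, inv_mul_cancel₀ h0]))
    (by rw [natDegree_C_mul (inv_ne_zero h0), hdeg])
    (by
      intro r hr hr1 hrd
      obtain ⟨x, hx⟩ := exists_root_of_degree_eq_one
        (by rw [degree_eq_natDegree hr.ne_zero, hr1]; rfl)
      have := eval_eq_zero_of_dvd_of_eval_eq_zero (hdvd.1 hrd) hx
      rw [eval_cubicForm] at this
      exact ha _ (fun h => by simpa using congrFun h 2) this)
    (fun r hr hr2 hrd => ha.not_dvd_of_natDegree_eq_two hr hr2 (hdvd.1 hrd))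
  have hm' : m = X ^ 2 + C (m.coeff 1) * X + C (m.coeff 0) := by
    have := hm.as_sum
    rw [hm2] at this
    simp only [Finset.sum_range_succ, Finset.sum_range_zero] at this
    rw [this]
    simp
    ring
  set s := m.coeff 1
  set t := m.coeff 0
  refine ⟨s, t, fun hst => hmf ?_, ?_⟩
  · rw [hm']
    simp [hst.1, hst.2]
  obtain ⟨n, hn⟩ := exists_algebraMap_comp_eq_prodCoeff F hE ![1, s, t]
  have key := map_cubicForm_eq_polyConjProd hn ![X ^ 2, X, 1]
  have hw : linForm (C ∘ ![1, s, t])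
      (fun i => (![X ^ 2, X, 1] i : F[X]).map (algebraMap F E)) = m := by
    rw [linForm_C_vec, hm']
    simp
  rw [hw, ← hp] at key
  have key2 := Polynomial.map_injective _ (algebraMap F E).injective key
  have key3 : cubicForm (C ∘ a) ![X ^ 2, X, 1] = C (a 0) * cubicForm (C ∘ n) ![X ^ 2, X, 1] := by
    rw [key2, ← mul_assoc, ← C_mul, mul_inv_cancel₀ h0, C_1, one_mul]
  rw [cubicForm_parabola, cubicForm_parabola] at key3
  have e (i : ℕ) := congrArg (fun p : F[X] => p.coeff i) key3
  have e0 := e 0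
  have e1 := e 1
  have e2 := e 2
  have e3 := e 3
  have e4 := e 4
  have e5 := e 5
  have e6 := e 6
  simp [coeff_X, coeff_C, coeff_X_pow, -map_add] at e0 e1 e2 e3 e4 e5 e6
  -- In the product of `l` with `xz - y²` the monomials `x²z`, `xyz`, `xz²` carry exactly the
  -- coefficients of `l`; the other seven equations hold by the comparison of sextics.
  refine ⟨![a 0 * n 2 - a 2, a 0 * n 4 - a 4, a 0 * n 5 - a 5],
    fun u hu => isDecomp_of_mulCoeff_eq (k := a 0) (n := n) ?_ hn hu⟩
  ext i
  fin_cases i <;> simp [mulCoeff]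
  all_goals
    first
    | linear_combination e0
    | linear_combination e1
    | linear_combination e2
    | linear_combination e3
    | linear_combination e4
    | linear_combination e5
    | linear_combination e6

/-- The line `-βx + y - αz` restricts to `X - α` on `x = 0` and to `X - β` on `z = 0`. At the common
point `(0 : 1 : 0)` both restrictions have the same leading coefficient, so they glue; a cubic
vanishing on both lines is a multiple of `xz`. -/
theorem isDecomp_pair {a : Fin 10 → F} {α β : E}
    (hα : (cubicForm (C ∘ a) ![0, X, 1]).map (algebraMap F E) =
      C (algebraMap F E (a 6)) * polyConjProd F (X - C α))
    (hβ : (cubicForm (C ∘ a) ![1, X, 0]).map (algebraMap F E) =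
      C (algebraMap F E (a 6)) * polyConjProd F (X - C β)) :
    ∃ l : Fin 3 → F, ∀ u : E, conjProd F u = algebraMap F E (a 6) →
        IsDecomp a ![0, 0, 1, 0, 0, 0] l (u • ![-β, 1, -α]) := by
  obtain ⟨n, hn⟩ := exists_algebraMap_comp_eq_prodCoeff F hE ![-β, 1, -α]
  have key := map_cubicForm_eq_polyConjProd hn ![0, X, 1]
  have key' := map_cubicForm_eq_polyConjProd hn ![1, X, 0]
  have hw : linForm (C ∘ ![-β, 1, -α])
      (fun i => (![0, X, 1] i : F[X]).map (algebraMap F E)) = X - C α := by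
    rw [linForm_C_vec]
    simp
    ring
  have hw' : linForm (C ∘ ![-β, 1, -α])
      (fun i => (![1, X, 0] i : F[X]).map (algebraMap F E)) = X - C β := by
    rw [linForm_C_vec]
    simp
    ring
  rw [hw] at key
  rw [hw'] at key'
  rw [← key, ← map_C, ← Polynomial.map_mul] at hα
  rw [← key', ← map_C, ← Polynomial.map_mul] at hβ
  have kα := Polynomial.map_injective _ (algebraMap F E).injective hα
  have kβ := Polynomial.map_injective _ (algebraMap F E).injective hβ
  rw [cubicForm_line, cubicForm_line] at kα
  rw [cubicForm_line', cubicForm_line'] at kβ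
  have e (i : ℕ) := congrArg (fun p : F[X] => p.coeff i) kα
  have f (i : ℕ) := congrArg (fun p : F[X] => p.coeff i) kβ
  have e0 := e 0
  have e1 := e 1
  have e2 := e 2
  have e3 := e 3
  have f0 := f 0
  have f1 := f 1
  have f2 := f 2
  simp [coeff_X, coeff_C, coeff_X_pow, -map_add] at e0 e1 e2 e3 f0 f1 f2
  refine ⟨![a 6 * n 2 - a 2, a 6 * n 4 - a 4, a 6 * n 5 - a 5],
    fun u hu => isDecomp_of_mulCoeff_eq (k := a 6) (n := n) ?_ hn hu⟩
  ext i
  fin_cases i <;> simp [mulCoeff]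
  all_goals
    first
    | linear_combination e0
    | linear_combination e1
    | linear_combination e2
    | linear_combination e3
    | linear_combination f0
    | linear_combination f1
    | linear_combination f2

theorem polyConjProd_X_sub_C_frob (α : E) :
    polyConjProd F (X - C (TernaryCubic.frob F α)) = polyConjProd F (X - C α) := by
  simp [polyConjProd, frob_frob_frob F hE]
  ring

/-- The conjugates on the two lines can be chosen independently, which is the source of the factor 9
in the count, against 3 for smooth conics. -/
theorem IsAnisotropic.exists_isDecomp_pair {a : Fin 10 → F} (ha : IsAnisotropic a) :
    ∃ α β : E, TernaryCubic.frob F α ≠ α ∧ TernaryCubic.frob F β ≠ β ∧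
      ∀ i j : Fin 3, ∃ l : Fin 3 → F,
      ∀ u : E, conjProd F u = algebraMap F E (a 6) →
        IsDecomp a ![0, 0, 1, 0, 0, 0] l
          (u • ![-(TernaryCubic.frob F)^[i] β, 1, -(TernaryCubic.frob F)^[j] α]) := by
  have h6 := ha.apply_six_ne
  have aux (w : Fin 3 → F[X]) (b c d : F)
      (hw : cubicForm (C ∘ a) w = C (a 6) * X ^ 3 + C b * X ^ 2 + C c * X + C d)
      (hw0 : ∀ x : F, (fun i => (w i).eval x) ≠ 0) :
      ∃ α : E, TernaryCubic.frob F α ≠ α ∧ (cubicForm (C ∘ a) w).map (algebraMap F E) =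
        C (algebraMap F E (a 6)) * polyConjProd F (X - C α) := by
    obtain ⟨α, hα, hp⟩ := exists_eq_polyConjProd_three hE
      (p := C (a 6)⁻¹ * cubicForm (C ∘ a) w)
      (monic_C_mul_of_mul_leadingCoeff_eq_one
        (by rw [hw, leadingCoeff_cubic h6, inv_mul_cancel₀ h6]))
      (by rw [natDegree_C_mul (inv_ne_zero h6), hw, natDegree_cubic h6])
      (by
        intro x
        rw [eval_mul, eval_C, eval_cubicForm]
        exact mul_ne_zero (inv_ne_zero h6) (ha _ (hw0 x)))
    refine ⟨α, hα, ?_⟩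
    rw [← hp, ← map_C, ← Polynomial.map_mul, ← mul_assoc, ← C_mul, mul_inv_cancel₀ h6, C_1,
      one_mul]
  obtain ⟨α, hα, hα'⟩ := aux _ _ _ _ (cubicForm_line a)
    (fun x h => by simpa using congrFun h 2)
  obtain ⟨β, hβ, hβ'⟩ := aux _ _ _ _ (cubicForm_line' a)
    (fun x h => by simpa using congrFun h 0)
  have hit (k : ℕ) (γ : E) : polyConjProd F (X - C ((TernaryCubic.frob F)^[k] γ)) =
      polyConjProd F (X - C γ) := by
    induction k with
    | zero => rfl
    | succ k ih => rw [Function.iterate_succ_apply', polyConjProd_X_sub_C_frob hE, ih]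
  exact ⟨α, β, hα, hβ, fun i j => isDecomp_pair hE (by rw [hα', hit]) (by rw [hβ', hit])⟩

end NormalForms

end TernaryCubic

namespace TernaryCubic

/-! ### Normal forms of conics -/

section Conics

section Polar

variable {R : Type*} [CommRing R]

theorem quadPolar_comm (c : Fin 6 → R) (v w : Fin 3 → R) : quadPolar c v w = quadPolar c w v := by
  simp only [quadPolar]; ring

theorem quadPolar_add (c : Fin 6 → R) (u v w : Fin 3 → R) :
    quadPolar c u (v + w) = quadPolar c u v + quadPolar c u w := by
  simp only [quadPolar, Pi.add_apply]; ring

theorem quadPolar_smul (c : Fin 6 → R) (r : R) (u v : Fin 3 → R) :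
    quadPolar c u (r • v) = r * quadPolar c u v := by
  simp only [quadPolar, Pi.smul_apply, smul_eq_mul]; ring

theorem quadPolar_self (c : Fin 6 → R) (v : Fin 3 → R) : quadPolar c v v = 2 * quadForm c v := by
  simp only [quadPolar, quadForm]; ring

theorem quadForm_add (c : Fin 6 → R) (v w : Fin 3 → R) :
    quadForm c (v + w) = quadForm c v + quadForm c w + quadPolar c v w := by
  simp only [quadPolar, quadForm, Pi.add_apply]; ring

theorem mulVec_mulVec_of_mul_eq_one {G G' : Matrix (Fin 3) (Fin 3) R} (h : G * G' = 1)
    (v : Fin 3 → R) : G.mulVec (G'.mulVec v) = v := by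
  rw [Matrix.mulVec_mulVec, h, Matrix.one_mulVec]

/-- The coefficients of the product of two linear forms. -/
def linMul (l m : Fin 3 → R) : Fin 6 → R :=
  ![l 0 * m 0, l 0 * m 1 + l 1 * m 0, l 0 * m 2 + l 2 * m 0, l 1 * m 1, l 1 * m 2 + l 2 * m 1,
    l 2 * m 2]

theorem quadForm_linMul (l m v : Fin 3 → R) :
    quadForm (linMul l m) v = linForm l v * linForm m v := by
  simp [quadForm, linMul, linForm]; ring

theorem map_linMul {S : Type*} [CommRing S] (φ : R →+* S) (l m : Fin 3 → R) :
    φ ∘ linMul l m = linMul (φ ∘ l) (φ ∘ m) := by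
  ext i
  fin_cases i <;> simp [linMul]

end Polar

variable {F : Type*} [Field F]

theorem exists_matrix_of_linearIndependent {u : Fin 3 → Fin 3 → F} (hu : LinearIndependent F u) :
    ∃ G G' : Matrix (Fin 3) (Fin 3) F, G * G' = 1 ∧ ∀ j, G.col j = u j := by
  let G : Matrix (Fin 3) (Fin 3) F := Matrix.of fun i j => u j i
  have hG : G.col = u := by ext i j; rfl
  have h : IsUnit G := Matrix.linearIndependent_cols_iff_isUnit.1 (by rwa [hG])
  exact ⟨G, G⁻¹, Matrix.mul_nonsing_inv G ((Matrix.isUnit_iff_isUnit_det G).1 h),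
    fun j => congrFun hG j⟩

/-- Two independent linear forms become coordinates after a change of coordinates. -/
theorem exists_matrix_linForm_eq {l m : Fin 3 → F} (h : LinearIndependent F ![l, m]) :
    ∃ G G' : Matrix (Fin 3) (Fin 3) F, G * G' = 1 ∧ G.transpose.mulVec l = Pi.single 0 1 ∧
      G.transpose.mulVec m = Pi.single 2 1 := by
  obtain ⟨k, hk⟩ := exists_linearIndependent_snoc_of_lt_finrank h (by simp)
  have hk' : LinearIndependent F ![l, k, m] := by
    have := hk.comp (Equiv.swap (1 : Fin 3) 2) (Equiv.injective _)
    have e : ![l, k, m] = Fin.snoc ![l, m] k ∘ Equiv.swap (1 : Fin 3) 2 := by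
      ext i : 1
      fin_cases i <;> rfl
    rwa [e]
  obtain ⟨H, H', hH, hc⟩ := exists_matrix_of_linearIndependent hk'
  have hT : H' * H = 1 := mul_eq_one_comm.1 hH
  refine ⟨H'.transpose, H.transpose, by rw [← Matrix.transpose_mul, hH, Matrix.transpose_one],
    ?_, ?_⟩
  · rw [Matrix.transpose_transpose, show l = H.mulVec (Pi.single 0 1) by
      rw [Matrix.mulVec_single_one, hc]; rfl, mulVec_mulVec_of_mul_eq_one hT]
  · rw [Matrix.transpose_transpose, show m = H.mulVec (Pi.single 2 1) by
      rw [Matrix.mulVec_single_one, hc]; rfl, mulVec_mulVec_of_mul_eq_one hT]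

/-- A conic all of whose rational points are nonsingular. -/
def IsSmoothConic (c : Fin 6 → F) : Prop :=
  ∀ v, v ≠ 0 → quadForm c v = 0 → ∃ w, quadPolar c v w ≠ 0

/-- Chevalley–Warning: the number of zeros is divisible by the characteristic, so zero is not the
only one. -/
theorem exists_quadForm_eq_zero [Fintype F] (c : Fin 6 → F) : ∃ v, v ≠ 0 ∧ quadForm c v = 0 := by
  classical
  open MvPolynomial in
  let p : MvPolynomial (Fin 3) F :=
    C (c 0) * X 0 ^ 2 + C (c 1) * (X 0 * X 1) + C (c 2) * (X 0 * X 2) + C (c 3) * X 1 ^ 2 +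
      C (c 4) * (X 1 * X 2) + C (c 5) * X 2 ^ 2
  have hp (v) : MvPolynomial.eval v p = quadForm c v := by
    simp [p, quadForm]
  have hd : p.totalDegree ≤ 2 := by
    have h1 (r : F) (i : Fin 3) : (MvPolynomial.C r * MvPolynomial.X i ^ 2).IsHomogeneous 2 := by
      simpa using (MvPolynomial.isHomogeneous_C (Fin 3) r).mul
        ((MvPolynomial.isHomogeneous_X F i).pow 2)
    have h2 (r : F) (i j : Fin 3) :
        (MvPolynomial.C r * (MvPolynomial.X i * MvPolynomial.X j)).IsHomogeneous 2 := by
      simpa using (MvPolynomial.isHomogeneous_C (Fin 3) r).mul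
        ((MvPolynomial.isHomogeneous_X F i).mul (MvPolynomial.isHomogeneous_X F j))
    exact ((((((h1 _ _).add (h2 _ _ _)).add (h2 _ _ _)).add (h1 _ _)).add (h2 _ _ _)).add
      (h1 _ _)).totalDegree_le
  obtain ⟨q, hq⟩ := CharP.exists F
  have hprime := CharP.char_is_prime F q
  have := char_dvd_card_solutions q (f := p) (by simpa using hd.trans_lt (by norm_num))
  by_contra! h
  have hcard : Fintype.card {x : Fin 3 → F // MvPolynomial.eval x p = 0} = 1 := by
    rw [Fintype.card_eq_one_iff]
    refine ⟨⟨0, by rw [hp]; simp [quadForm]⟩, ?_⟩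
    rintro ⟨y, hy⟩
    rw [hp] at hy
    by_contra hne
    exact h y (fun h0 => hne (Subtype.ext h0)) hy
  rw [hcard] at this
  exact hprime.one_lt.ne' (Nat.dvd_one.1 this)

/-- A smooth conic over a finite field has the normal form `X Z = Y ^ 2`. -/
theorem IsSmoothConic.exists_normalForm [Fintype F] {c : Fin 6 → F} (hc : IsSmoothConic c) :
    ∃ (G G' : Matrix (Fin 3) (Fin 3) F) (k : F), G * G' = 1 ∧ k ≠ 0 ∧
      quadForm c (G.col 0) = 0 ∧ quadForm c (G.col 1) = -k ∧ quadForm c (G.col 2) = 0 ∧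
      quadPolar c (G.col 0) (G.col 1) = 0 ∧ quadPolar c (G.col 0) (G.col 2) = k ∧
      quadPolar c (G.col 1) (G.col 2) = 0 := by
  obtain ⟨o, ho, hco⟩ := exists_quadForm_eq_zero c
  obtain ⟨w, hw⟩ := hc o ho hco
  let B : (Fin 3 → F) →ₗ[F] F :=
    { toFun := quadPolar c o
      map_add' := quadPolar_add c o
      map_smul' := fun r v => quadPolar_smul c r o v }
  have hBo : quadPolar c o o = 0 := by rw [quadPolar_self, hco, mul_zero]
  -- The tangent at `o` is the kernel of a functional on a three-dimensional space, so it is larger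
  -- than the span of `o`.
  obtain ⟨v, hv, hvo⟩ : ∃ v, quadPolar c o v = 0 ∧ ∀ r : F, v ≠ r • o := by
    by_contra! h
    have hle : LinearMap.ker B ≤ Submodule.span F {o} := by
      intro v hv
      obtain ⟨r, rfl⟩ := h v hv
      exact Submodule.smul_mem _ _ (Submodule.mem_span_singleton_self o)
    have h1 := Submodule.finrank_mono hle
    have h2 := B.finrank_range_add_finrank_ker
    have h3 : Module.finrank F (LinearMap.range B) ≤ 1 := by
      simpa using Submodule.finrank_le (LinearMap.range B)
    have h4 := finrank_span_singleton (K := F) ho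
    simp only [Module.finrank_fin_fun] at h2
    omega
  obtain ⟨w', hBw⟩ : ∃ w', quadPolar c o w' = 1 :=
    ⟨(quadPolar c o w)⁻¹ • w, by rw [quadPolar_smul, inv_mul_cancel₀ hw]⟩
  -- Multiples of `o` are added so that `u₂` lies on the conic and `u₁` is polar to both `o` and
  -- `u₂`.
  set u₁ := v + (-quadPolar c v w') • o with hu₁
  set u₂ := w' + (-quadForm c w') • o with hu₂
  have h01 : quadPolar c o u₁ = 0 := by
    rw [hu₁, quadPolar_add, quadPolar_smul, hv, hBo]; ring
  have h02 : quadPolar c o u₂ = 1 := by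
    rw [hu₂, quadPolar_add, quadPolar_smul, hBw, hBo]; ring
  have h2 : quadForm c u₂ = 0 := by
    rw [hu₂, quadForm_add, quadForm_smul, quadPolar_smul, hco, quadPolar_comm, hBw]; ring
  have h12 : quadPolar c u₁ u₂ = 0 := by
    rw [quadPolar_comm, hu₁, quadPolar_add, quadPolar_smul, quadPolar_comm c u₂ o, h02, hu₂,
      quadPolar_comm, quadPolar_add, quadPolar_smul, quadPolar_comm c v o, hv]; ring
  have hind (k : F) (hk : k ≠ 0) : LinearIndependent F ![k • o, u₁, u₂] := by
    rw [Fintype.linearIndependent_iff]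
    intro g hg
    simp only [Fin.sum_univ_three, Matrix.cons_val] at hg
    have g2 : g 2 = 0 := by
      have := congrArg (quadPolar c o) hg
      simp only [quadPolar_add, quadPolar_smul, hBo, h01, h02] at this
      simpa [quadPolar] using this
    have g1 : g 1 = 0 := by
      by_contra h
      apply hvo (quadPolar c v w' - (g 1)⁻¹ * g 0 * k)
      rw [g2, zero_smul, add_zero] at hg
      have hg' := congrArg (fun x => (g 1)⁻¹ • x) hg
      simp only [smul_add, smul_smul, inv_mul_cancel₀ h, one_smul, hu₁, smul_zero, neg_smul] at hg'
      rw [sub_smul]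
      linear_combination (norm := module) hg'
    have g0 : g 0 = 0 := by
      rw [g2, g1, zero_smul, zero_smul, add_zero, add_zero, smul_smul] at hg
      simpa [ho, hk] using hg
    intro i
    fin_cases i <;> assumption
  -- Otherwise `u₁` would be a point of the conic polar to the whole basis, hence singular.
  have h1 : quadForm c u₁ ≠ 0 := by
    intro h1
    have hu₁0 : u₁ ≠ 0 := (hind 1 one_ne_zero).ne_zero 1
    obtain ⟨x, hx⟩ := hc u₁ hu₁0 h1
    obtain ⟨G, G', hG, hGc⟩ := exists_matrix_of_linearIndependent (hind 1 one_ne_zero)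
    apply hx
    rw [← mulVec_mulVec_of_mul_eq_one hG x, mulVec_eq_comb, hGc, hGc, hGc]
    simp only [Matrix.cons_val, one_smul, quadPolar_add, quadPolar_smul, quadPolar_self, h1, h12,
      quadPolar_comm c u₁ o, h01]
    ring
  -- Rescaling `o` by `k = -quadForm c u₁` gives the coefficients of `xz` and `y²` opposite signs,
  -- so the conic becomes `k (xz - y²)`.
  obtain ⟨G, G', hG, hGc⟩ := exists_matrix_of_linearIndependent
    (hind (-quadForm c u₁) (neg_ne_zero.2 h1))
  refine ⟨G, G', -quadForm c u₁, hG, neg_ne_zero.2 h1, ?_⟩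
  rw [hGc, hGc, hGc]
  simp only [Matrix.cons_val, quadForm_smul, quadPolar_comm c (_ • o), quadPolar_smul,
    quadPolar_comm c _ o, h01, h02, h12, h2, hco]
  simp

end Conics

end TernaryCubic

namespace TernaryCubic

/-! ### Counting decompositions -/

section Fibres

variable {F E : Type*} [Field F] [Fintype F] [Field E] [Algebra F E]

/-- The linear forms over the extension whose norm form is congruent to the cubic form `a` modulo
the quadratic form `c`. -/
def repSet (E : Type*) [Field E] [Algebra F E] (a : Fin 10 → F) (c : Fin 6 → F) :
    Set (Fin 3 → E) :=
  {m | ∃ l, IsDecomp a c l m}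

omit [Fintype F] in
theorem algebraMap_comp_mulVec (G : Matrix (Fin 3) (Fin 3) F) (v : Fin 3 → F) :
    algebraMap F E ∘ G.mulVec v = (G.map (algebraMap F E)).mulVec (algebraMap F E ∘ v) := by
  ext i
  simp [Matrix.mulVec, dotProduct]

omit [Fintype F] in
theorem map_mul_map_eq_one {G G' : Matrix (Fin 3) (Fin 3) F} (h : G * G' = 1) :
    G.map (algebraMap F E) * G'.map (algebraMap F E) = 1 := by
  rw [← Matrix.map_mul, h, Matrix.map_one _ (map_zero _) (map_one _)]

omit [Fintype F] in
theorem IsAnisotropic.subst {a : Fin 10 → F} (ha : IsAnisotropic a)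
    {G G' : Matrix (Fin 3) (Fin 3) F} (h : G * G' = 1) : IsAnisotropic (cubicSubst a G) := by
  intro v hv
  rw [cubicForm_cubicSubst]
  apply ha
  intro h0
  apply hv
  rw [← mulVec_mulVec_of_mul_eq_one (mul_eq_one_comm.1 h) v, h0, Matrix.mulVec_zero]

/-- A rational change of coordinates commutes with Frobenius, so it carries norm forms to norm
forms; the scalar `k` on the conic is absorbed into `l`. -/
theorem IsDecomp.of_subst {a : Fin 10 → F} {G G' : Matrix (Fin 3) (Fin 3) F} (h : G * G' = 1)
    {c c' : Fin 6 → F} {k : F} (hk : k ≠ 0)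
    (hc : ∀ v : Fin 3 → E, quadForm (algebraMap F E ∘ c) ((G.map (algebraMap F E)).mulVec v) =
      algebraMap F E k * quadForm (algebraMap F E ∘ c') v)
    {l : Fin 3 → F} {m : Fin 3 → E} (hd : IsDecomp (cubicSubst a G) c' l m) :
    IsDecomp a c (k⁻¹ • G'.transpose.mulVec l)
      ((G'.map (algebraMap F E)).transpose.mulVec m) := by
  intro v
  set w := (G'.map (algebraMap F E)).mulVec v with hw
  have hv : (G.map (algebraMap F E)).mulVec w = v :=
    mulVec_mulVec_of_mul_eq_one (map_mul_map_eq_one h) v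
  have h1 := hd w
  have hk' : algebraMap F E k ≠ 0 := by simpa using hk
  rw [map_cubicSubst, cubicForm_cubicSubst, hv, hw, normForm_mulVec, linForm_mulVec, ← hw] at h1
  rw [h1]
  congr 1
  have h2 := hc w
  rw [hv] at h2
  rw [h2]
  have h3 : algebraMap F E ∘ (k⁻¹ • G'.transpose.mulVec l) =
      (algebraMap F E k)⁻¹ • ((G'.map (algebraMap F E)).transpose.mulVec (algebraMap F E ∘ l)) := by
    ext i
    simp [Matrix.mulVec, dotProduct]
  rw [h3]
  simp only [linForm, Pi.smul_apply, smul_eq_mul]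
  field_simp

theorem mulVec_injective_of_mul_eq_one {R : Type*} [CommRing R] {G G' : Matrix (Fin 3) (Fin 3) R}
    (h : G * G' = 1) : Function.Injective G'.mulVec := fun v w hvw => by
  rw [← mulVec_mulVec_of_mul_eq_one h v, hvw, mulVec_mulVec_of_mul_eq_one h]

theorem ncard_repSet_subst_le [Finite E] {a : Fin 10 → F} {G G' : Matrix (Fin 3) (Fin 3) F}
    (h : G * G' = 1) {c c' : Fin 6 → F} {k : F} (hk : k ≠ 0)
    (hc : ∀ v : Fin 3 → E, quadForm (algebraMap F E ∘ c) ((G.map (algebraMap F E)).mulVec v) =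
      algebraMap F E k * quadForm (algebraMap F E ∘ c') v) :
    (repSet E (cubicSubst a G) c').ncard ≤ (repSet E a c).ncard := by
  refine Set.ncard_le_ncard_of_injOn ((G'.map (algebraMap F E)).transpose.mulVec) ?_ ?_
    (Set.toFinite _)
  · rintro m ⟨l, hl⟩
    exact ⟨_, hl.of_subst h hk hc⟩
  · apply Function.Injective.injOn
    apply mulVec_injective_of_mul_eq_one (G := (G.map (algebraMap F E)).transpose)
    rw [← Matrix.transpose_mul, map_mul_map_eq_one (mul_eq_one_comm.1 h), Matrix.transpose_one]

variable (hE : Module.finrank F E = 3)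
include hE

/-- Frobenius has order dividing the prime 3, so an element it moves has three distinct conjugates.
-/
theorem frob_iterate_injective {x : E} (hx : frob F x ≠ x) :
    Function.Injective (fun j : Fin 3 => (frob F)^[j] x) := by
  have h3 := frob_frob_frob F hE x
  have hinj := (frob F : E →ₐ[F] E).toRingHom.injective
  have h2 : frob F (frob F x) ≠ x := fun h => hx (by rw [h] at h3; exact h3)
  have h21 : frob F (frob F x) ≠ frob F x := fun h => hx (hinj h)
  intro i j hij
  have hij' : (frob F)^[(i : ℕ)] x = (frob F)^[(j : ℕ)] x := hij
  fin_cases i <;> fin_cases j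
  all_goals
    first
    | rfl
    | exact absurd hij' hx
    | exact absurd hij'.symm hx
    | exact absurd hij' h2
    | exact absurd hij'.symm h2
    | exact absurd hij' h21
    | exact absurd hij'.symm h21

/-- Three conjugates of the line, times `q² + q + 1` scalars `u` of norm `a 0`. The first entry `1`
recovers `u`, after which the conjugate is visible in `s` or in `t`. -/
theorem le_ncard_repSet_parabola {a : Fin 10 → F} (ha : IsAnisotropic a) :
    3 * (Fintype.card F ^ 2 + Fintype.card F + 1) ≤
      (repSet E a ![0, 0, 1, -1, 0, 0]).ncard := by
  have := finite_of_finrank_eq_three F hE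
  obtain ⟨s, t, hst, l, hl⟩ := ha.exists_isDecomp_parabola hE
  have hmem (j : ℕ) (u : E) (hu : conjProd F u = algebraMap F E (a 0)) :
      u • ![1, (frob F)^[j] s, (frob F)^[j] t] ∈ repSet E a ![0, 0, 1, -1, 0, 0] := by
    refine ⟨l, ?_⟩
    induction j with
    | zero => exact hl u hu
    | succ j ih =>
      have := ih.frob hE
      rw [frob_comp_vec, map_one] at this
      rwa [Function.iterate_succ_apply', Function.iterate_succ_apply']
  let f : Fin 3 × {u : E // conjProd F u = algebraMap F E (a 0)} →
      repSet E a ![0, 0, 1, -1, 0, 0] :=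
    fun p => ⟨_, hmem p.1 p.2 p.2.2⟩
  have hf : Function.Injective f := by
    rintro ⟨i, u, hu⟩ ⟨j, v, hv⟩ h
    have h' : u • ![1, (frob F)^[i] s, (frob F)^[i] t] =
      v • ![1, (frob F)^[j] s, (frob F)^[j] t] := congrArg Subtype.val h
    have huv : u = v := by simpa using congrFun h' 0
    subst huv
    have hu0 : u ≠ 0 := by
      rintro rfl
      rw [(conjProd_eq_zero F).2 rfl] at hu
      exact ha.apply_zero_ne ((map_eq_zero _).1 hu.symm)
    have h1 : (frob F)^[i] s = (frob F)^[j] s := by simpa [hu0] using congrFun h' 1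
    have h2 : (frob F)^[i] t = (frob F)^[j] t := by simpa [hu0] using congrFun h' 2
    have hij : i = j := by
      by_cases hs : frob F s = s
      · exact frob_iterate_injective hE (fun ht => hst ⟨hs, ht⟩) h2
      · exact frob_iterate_injective hE hs h1
    rw [hij]
  have := Nat.card_le_card_of_injective f hf
  rwa [Nat.card_prod, natCard_conjProd_eq F hE ha.apply_zero_ne, Nat.card_coe_set_eq,
    Nat.card_eq_fintype_card, Fintype.card_fin] at this

theorem le_ncard_repSet_pair {a : Fin 10 → F} (ha : IsAnisotropic a) :
    9 * (Fintype.card F ^ 2 + Fintype.card F + 1) ≤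
      (repSet E a ![0, 0, 1, 0, 0, 0]).ncard := by
  have := finite_of_finrank_eq_three F hE
  obtain ⟨α, β, hα, hβ, h⟩ := ha.exists_isDecomp_pair hE
  let f : (Fin 3 × Fin 3) × {u : E // conjProd F u = algebraMap F E (a 6)} →
      repSet E a ![0, 0, 1, 0, 0, 0] :=
    fun p => ⟨_, _, (h p.1.1 p.1.2).choose_spec p.2 p.2.2⟩
  have hf : Function.Injective f := by
    rintro ⟨⟨i, j⟩, u, hu⟩ ⟨⟨i', j'⟩, v, hv⟩ h
    have h' : u • ![-(frob F)^[i] β, 1, -(frob F)^[j] α] =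
      v • ![-(frob F)^[i'] β, 1, -(frob F)^[j'] α] := congrArg Subtype.val h
    have huv : u = v := by simpa using congrFun h' 1
    subst huv
    have hu0 : u ≠ 0 := by
      rintro rfl
      rw [(conjProd_eq_zero F).2 rfl] at hu
      exact ha.apply_six_ne ((map_eq_zero _).1 hu.symm)
    have h1 : (frob F)^[i] β = (frob F)^[i'] β := by simpa [hu0] using congrFun h' 0
    have h2 : (frob F)^[j] α = (frob F)^[j'] α := by simpa [hu0] using congrFun h' 2
    rw [frob_iterate_injective hE hβ h1, frob_iterate_injective hE hα h2]
  have := Nat.card_le_card_of_injective f hf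
  rwa [Nat.card_prod, natCard_conjProd_eq F hE ha.apply_six_ne, Nat.card_coe_set_eq,
    Nat.card_eq_fintype_card, Fintype.card_prod, Fintype.card_fin] at this

theorem le_ncard_repSet_of_isSmoothConic {a : Fin 10 → F} (ha : IsAnisotropic a) {c : Fin 6 → F}
    (hc : IsSmoothConic c) :
    3 * (Fintype.card F ^ 2 + Fintype.card F + 1) ≤ (repSet E a c).ncard := by
  have := finite_of_finrank_eq_three F hE
  obtain ⟨G, G', k, hG, hk, h0, h1, h2, h01, h02, h12⟩ := hc.exists_normalForm
  refine (le_ncard_repSet_parabola hE (ha.subst hG)).trans (ncard_repSet_subst_le hG hk ?_)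
  intro v
  have hcol (j : Fin 3) : (G.map (algebraMap F E)).col j = algebraMap F E ∘ G.col j := rfl
  rw [mulVec_eq_comb, quadForm_comb]
  simp only [hcol, ← map_quadForm, ← map_quadPolar, h0, h1, h2, h01, h02, h12]
  simp [quadForm]
  ring

theorem le_ncard_repSet_linMul {a : Fin 10 → F} (ha : IsAnisotropic a) {l m : Fin 3 → F}
    (h : LinearIndependent F ![l, m]) :
    9 * (Fintype.card F ^ 2 + Fintype.card F + 1) ≤ (repSet E a (linMul l m)).ncard := by
  have := finite_of_finrank_eq_three F hE
  obtain ⟨G, G', hG, hl, hm⟩ := exists_matrix_linForm_eq h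
  refine (le_ncard_repSet_pair hE (ha.subst hG)).trans
    (ncard_repSet_subst_le hG one_ne_zero ?_)
  intro v
  have haux (k : Fin 3 → F) : (G.map (algebraMap F E)).transpose.mulVec (algebraMap F E ∘ k) =
      algebraMap F E ∘ G.transpose.mulVec k := by
    rw [algebraMap_comp_mulVec]; rfl
  rw [map_linMul, quadForm_linMul, linForm_mulVec, linForm_mulVec, haux, haux, hl, hm]
  simp [quadForm, linForm]

open Polynomial in
/-- The number of linear forms over the extension whose norm form is congruent to an anisotropic
cubic form modulo a given rational line. -/
theorem ncard_setOf_isDecomp_le {a : Fin 10 → F} (ha : IsAnisotropic a) {l : Fin 3 → F}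
    (hl : l ≠ 0) :
    {m : Fin 3 → E | ∃ c, IsDecomp a c l m}.ncard ≤
      3 * (Fintype.card F ^ 2 + Fintype.card F + 1) * Fintype.card F ^ 3 := by
  have := finite_of_finrank_eq_three F hE
  classical
  obtain ⟨k, hk⟩ := exists_linearIndependent_snoc_of_lt_finrank
    (LinearIndependent.of_subsingleton (R := F) (v := ![l]) 0 hl) (by simp)
  have hkl : LinearIndependent F ![k, l] := by
    have e : ![k, l] = Fin.snoc ![l] k ∘ Equiv.swap (0 : Fin 2) 1 := by
      ext i : 1
      fin_cases i <;> rfl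
    rw [e]
    exact hk.comp _ (Equiv.injective _)
  obtain ⟨G, G', hG, -, hGl⟩ := exists_matrix_linForm_eq hkl
  set b := cubicSubst a G with hb
  have hba := ha.subst hG
  rw [← hb] at hba
  let p : E[X] := cubicForm (C ∘ algebraMap F E ∘ b) ![X, 1, 0]
  have hp : p ≠ 0 := by
    intro h0
    have := congrArg (fun p : E[X] => p.coeff 3) h0
    simp [p, cubicForm] at this
    exact hba.apply_zero_ne this
  have hpd : p.natDegree ≤ 3 := by
    simp only [p, cubicForm, Function.comp_apply, Matrix.cons_val]
    compute_degree!
  have hpr : p.roots.toFinset.card ≤ 3 :=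
    (Multiset.toFinset_card_le _).trans ((card_roots' p).trans hpd)
  -- In coordinates where `l` is the last coordinate, the term `l c` vanishes on `z = 0`, so the
  -- norm form of `m'` is known there. Its first coefficient `u` has prescribed norm, the zero of
  -- `m'` on this line is one of at most three roots of `p`, and the last coefficient is an
  -- arbitrary element of `E`.
  have key : ∀ m : Fin 3 → E, (∃ c, IsDecomp a c l m) →
      ∃ (u : {u : E // conjProd F u = algebraMap F E (b 0)}) (r : p.roots.toFinset) (z : E),
        m = (G'.map (algebraMap F E)).transpose.mulVec ![u, -(r * u), z] := by
    rintro m ⟨c, hc⟩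
    set m' := (G.map (algebraMap F E)).transpose.mulVec m with hm'
    have hline (x y : E) : cubicForm (algebraMap F E ∘ b) ![x, y, 0] =
        normForm F m' ![x, y, 0] := by
      have haux : (G.map (algebraMap F E)).transpose.mulVec (algebraMap F E ∘ l) =
          algebraMap F E ∘ G.transpose.mulVec l := by
        rw [algebraMap_comp_mulVec]; rfl
      rw [hb, map_cubicSubst, cubicForm_cubicSubst, hc, normForm_mulVec, linForm_mulVec, haux, hGl, ← hm']
      simp [linForm]
    have h1 : conjProd F (m' 0) = algebraMap F E (b 0) := by
      have := hline 1 0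
      simpa [cubicForm, normForm, linForm, conjProd] using this.symm
    have h0 : m' 0 ≠ 0 := by
      intro h0
      rw [h0, (conjProd_eq_zero F).2 rfl] at h1
      exact hba.apply_zero_ne ((map_eq_zero _).1 h1.symm)
    have h2 : p.eval (-(m' 1 / m' 0)) = 0 := by
      have h3 := hline (-(m' 1 / m' 0)) 1
      have h4 : linForm m' ![-(m' 1 / m' 0), 1, 0] = 0 := by
        simp [linForm]
        field_simp
        ring
      rw [normForm, h4, zero_mul, zero_mul] at h3
      rw [eval_cubicForm, ← h3]
      congr 1
      ext i
      fin_cases i <;> simp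
    refine ⟨⟨m' 0, h1⟩, ⟨-(m' 1 / m' 0), by simpa [hp] using h2⟩, m' 2, ?_⟩
    have h5 : ![m' 0, -(-(m' 1 / m' 0) * m' 0), m' 2] = m' := by
      ext i
      fin_cases i <;> simp [h0]
    simp only [h5]
    rw [hm', mulVec_mulVec_of_mul_eq_one]
    rw [← Matrix.transpose_mul, map_mul_map_eq_one hG, Matrix.transpose_one]
  let g : {u : E // conjProd F u = algebraMap F E (b 0)} × p.roots.toFinset × E → (Fin 3 → E) :=
    fun q => (G'.map (algebraMap F E)).transpose.mulVec ![q.1, -(q.2.1 * q.1), q.2.2]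
  have hsub : {m : Fin 3 → E | ∃ c, IsDecomp a c l m} ⊆ Set.range g := by
    intro m hm
    obtain ⟨u, r, z, h⟩ := key m hm
    exact ⟨(u, r, z), h.symm⟩
  refine (Set.ncard_le_ncard hsub (Set.toFinite _)).trans ?_
  rw [← Nat.card_coe_set_eq]
  refine (Finite.card_range_le g).trans ?_
  rw [Nat.card_prod, Nat.card_prod, natCard_conjProd_eq F hE hba.apply_zero_ne, natCard_eq F hE,
    Nat.card_eq_fintype_card (α := p.roots.toFinset), Fintype.card_coe]
  calc _ ≤ (Fintype.card F ^ 2 + Fintype.card F + 1) * (3 * Fintype.card F ^ 3) := by gcongr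
    _ = _ := by ring

end Fibres

end TernaryCubic

namespace TernaryCubic

/-! ### Counting conics -/

section CountConics

variable {F : Type*} [Field F]

theorem quadForm_eq_zero {c : Fin 6 → F} (h : ∀ v, quadForm c v = 0) : c = 0 := by
  have e (x y z : F) := h ![x, y, z]
  simp only [quadForm, Matrix.cons_val] at e
  have c0 : c 0 = 0 := by linear_combination e 1 0 0
  have c3 : c 3 = 0 := by linear_combination e 0 1 0
  have c5 : c 5 = 0 := by linear_combination e 0 0 1
  have c1 : c 1 = 0 := by linear_combination e 1 1 0 - c0 - c3
  have c2 : c 2 = 0 := by linear_combination e 1 0 1 - c0 - c5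
  have c4 : c 4 = 0 := by linear_combination e 0 1 1 - c3 - c5
  ext i
  fin_cases i <;> assumption

theorem quadForm_sub (c c' : Fin 6 → F) (v : Fin 3 → F) :
    quadForm (c - c') v = quadForm c v - quadForm c' v := by
  simp [quadForm]; ring

theorem quadPolar_sub (c c' : Fin 6 → F) (v w : Fin 3 → F) :
    quadPolar (c - c') v w = quadPolar c v w - quadPolar c' v w := by
  simp [quadPolar]; ring

/-- The intersection of the two lines is a singular rational point. This keeps the two families of
conics in the lower bound disjoint. -/
theorem not_isSmoothConic_linMul {l m : Fin 3 → F} (h : LinearIndependent F ![l, m]) :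
    ¬ IsSmoothConic (linMul l m) := by
  obtain ⟨G, G', hG, hl, hm⟩ := exists_matrix_linForm_eq h
  intro hs
  have hl0 : linForm l (G.mulVec (Pi.single 1 1)) = 0 := by
    rw [linForm_mulVec, hl]; simp [linForm]
  have hm0 : linForm m (G.mulVec (Pi.single 1 1)) = 0 := by
    rw [linForm_mulVec, hm]; simp [linForm]
  obtain ⟨w, hw⟩ := hs (G.mulVec (Pi.single 1 1)) (by
    intro h0
    have := mulVec_mulVec_of_mul_eq_one (mul_eq_one_comm.1 hG) (Pi.single 1 (1 : F))
    rw [h0, Matrix.mulVec_zero] at this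
    simpa using congrFun this 1) (by rw [quadForm_linMul, hl0, zero_mul])
  apply hw
  have : ∀ v, quadPolar (linMul l m) v w = linForm l v * linForm m w + linForm l w * linForm m v := by
    intro v
    simp [quadPolar, linMul, linForm]; ring
  rw [this, hl0, hm0]
  ring

/-- The factorization of a quadratic form into linear forms is unique. -/
theorem linMul_eq_linMul {l m l' m' : Fin 3 → F} (h : LinearIndependent F ![l, m])
    (h' : linMul l' m' = linMul l m) :
    ∃ r : Fˣ, (l' = r • l ∧ m' = r⁻¹ • m) ∨ (l' = r • m ∧ m' = r⁻¹ • l) := by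
  obtain ⟨G, G', hG, hl, hm⟩ := exists_matrix_linForm_eq h
  have hT : G'.transpose * G.transpose = 1 := by
    rw [← Matrix.transpose_mul, hG, Matrix.transpose_one]
  have hinj := mulVec_injective_of_mul_eq_one hT
  set L := G.transpose.mulVec l' with hL
  set M := G.transpose.mulVec m' with hM
  have hLM : linMul L M = ![0, 0, 1, 0, 0, 0] := by
    rw [← sub_eq_zero]
    apply quadForm_eq_zero
    intro v
    rw [quadForm_sub, quadForm_linMul, hL, hM, ← linForm_mulVec, ← linForm_mulVec,
      ← quadForm_linMul, h', quadForm_linMul, linForm_mulVec, linForm_mulVec, hl, hm]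
    simp [quadForm, linForm]
  have e (i) := congrFun hLM i
  have e0 := e 0
  have e1 := e 1
  have e2 := e 2
  have e3 := e 3
  have e4 := e 4
  have e5 := e 5
  simp only [linMul, Matrix.cons_val] at e0 e1 e2 e3 e4 e5
  have hsingle (x : Fin 3 → F) : x = x 0 • Pi.single 0 1 + x 1 • Pi.single 1 1 +
      x 2 • Pi.single 2 1 := by
    ext i
    fin_cases i <;> simp
  have hsmul (r : Fˣ) (k : Fin 3 → F) : G.transpose.mulVec (r • k) =
      (r : F) • G.transpose.mulVec k := by
    rw [Units.smul_def, Matrix.mulVec_smul]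
  -- The form has become `xz = L M`; whether `L 0` vanishes decides if `L` is a multiple of `z` or
  -- of `x`.
  by_cases h0 : L 0 = 0
  · have hu : L 2 * M 0 = 1 := by simpa [h0] using e2
    have hM0 : M 0 ≠ 0 := right_ne_zero_of_mul_eq_one hu
    have hL2 : L 2 ≠ 0 := left_ne_zero_of_mul_eq_one hu
    have hL1 : L 1 = 0 := by simpa [h0, hM0] using e1
    have hM2 : M 2 = 0 := by simpa [hL2] using e5
    have hM1 : M 1 = 0 := by simpa [hL1, hL2] using e4
    refine ⟨Units.mk0 (L 2) hL2, Or.inr ⟨hinj ?_, hinj ?_⟩⟩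
    · rw [hsmul, hm, ← hL, Units.val_mk0]
      conv_lhs => rw [hsingle L, h0, hL1]
      simp
    · rw [hsmul, hl, ← hM, hsingle M, hM1, hM2]
      simp [eq_inv_of_mul_eq_one_right hu]
  · have hM0 : M 0 = 0 := by simpa [h0] using e0
    have hu : L 0 * M 2 = 1 := by simpa [hM0] using e2
    have hM2 : M 2 ≠ 0 := right_ne_zero_of_mul_eq_one hu
    have hM1 : M 1 = 0 := by simpa [h0, hM0] using e1
    have hL2 : L 2 = 0 := by simpa [hM2] using e5
    have hL1 : L 1 = 0 := by simpa [hM1, hM2] using e4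
    refine ⟨Units.mk0 (L 0) h0, Or.inl ⟨hinj ?_, hinj ?_⟩⟩
    · rw [hsmul, hl, ← hL, Units.val_mk0]
      conv_lhs => rw [hsingle L, hL2, hL1]
      simp
    · rw [hsmul, hm, ← hM, hsingle M, hM1, hM0]
      simp [eq_inv_of_mul_eq_one_right hu]

open scoped Classical in
/-- The number of products of two independent linear forms. -/
theorem card_linMul_image [Fintype F] :
    (Fintype.card F ^ 3 - 1) * (Fintype.card F ^ 3 - Fintype.card F) ≤
      2 * (Fintype.card F - 1) *
        ((Finset.univ.filter fun s : Fin 2 → Fin 3 → F => LinearIndependent F s).image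
          fun s => linMul (s 0) (s 1)).card := by
  have h1 : (Finset.univ.filter fun s : Fin 2 → Fin 3 → F => LinearIndependent F s).card =
      (Fintype.card F ^ 3 - 1) * (Fintype.card F ^ 3 - Fintype.card F) := by
    have := card_linearIndependent (K := F) (V := Fin 3 → F) (k := 2) (by simp)
    rw [Nat.card_eq_fintype_card, Fintype.card_subtype] at this
    rw [this, Fin.prod_univ_two]
    simp
  rw [← h1]
  -- By unique factorization a fibre has at most `2(q - 1)` elements: the order of the factors and a
  -- scalar moved between them.
  refine Finset.card_le_mul_card_image _ _ ?_
  intro c hc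
  obtain ⟨s, hs, rfl⟩ := Finset.mem_image.1 hc
  have hs' : LinearIndependent F ![s 0, s 1] := by
    convert! (Finset.mem_filter.1 hs).2
    ext i : 1
    fin_cases i <;> rfl
  let f : Bool × Fˣ → Fin 2 → Fin 3 → F :=
    fun p => if p.1 then ![p.2 • s 0, p.2⁻¹ • s 1] else ![p.2 • s 1, p.2⁻¹ • s 0]
  calc _ ≤ (Finset.univ.image f).card := by
        refine Finset.card_le_card fun t ht => ?_
        rw [Finset.mem_filter] at ht
        obtain ⟨r, ⟨h0, h1⟩ | ⟨h0, h1⟩⟩ := linMul_eq_linMul hs' ht.2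
        · refine Finset.mem_image.2 ⟨(true, r), Finset.mem_univ _, ?_⟩
          ext i : 1
          fin_cases i
          · exact h0.symm
          · exact h1.symm
        · refine Finset.mem_image.2 ⟨(false, r), Finset.mem_univ _, ?_⟩
          ext i : 1
          fin_cases i
          · exact h0.symm
          · exact h1.symm
    _ ≤ Fintype.card (Bool × Fˣ) := Finset.card_image_le
    _ = _ := by rw [Fintype.card_prod, Fintype.card_bool, Fintype.card_units]

-- If a coordinate of `v` is nonzero, the conic is determined by its three coefficients in the other
-- two variables: singularity at `v` determines the rest. So nonzero conics singular at `v` inject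
-- into nonzero vectors of `F³`.
open scoped Classical in
theorem card_singular_le [Fintype F] {v : Fin 3 → F} (hv : v ≠ 0) :
    (Finset.univ.filter fun c : Fin 6 → F =>
      c ≠ 0 ∧ quadForm c v = 0 ∧ ∀ w, quadPolar c v w = 0).card ≤ Fintype.card F ^ 3 - 1 := by
  obtain ⟨f, hf⟩ : ∃ f : (Fin 6 → F) → (Fin 3 → F), f 0 = 0 ∧ ∀ c c', f c = f c' →
      (quadForm c v = 0 ∧ ∀ w, quadPolar c v w = 0) →
      (quadForm c' v = 0 ∧ ∀ w, quadPolar c' v w = 0) → c = c' := by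
    suffices ∃ f : (Fin 6 → F) → (Fin 3 → F), f 0 = 0 ∧ (∀ c c', f (c - c') = f c - f c') ∧
        ∀ c, f c = 0 → quadForm c v = 0 → (∀ w, quadPolar c v w = 0) → c = 0 by
      obtain ⟨f, hf0, hfs, hf⟩ := this
      refine ⟨f, hf0, fun c c' h h1 h2 => sub_eq_zero.1 (hf _ ?_ ?_ fun w => ?_)⟩
      · rw [hfs, h, sub_self]
      · rw [quadForm_sub, h1.1, h2.1, sub_self]
      · rw [quadPolar_sub, h1.2, h2.2, sub_self]
    have hsub (i j k : Fin 6) (c c' : Fin 6 → F) :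
        ![(c - c') i, (c - c') j, (c - c') k] = ![c i, c j, c k] - ![c' i, c' j, c' k] := by
      simp
    have h000 : ![(0 : F), 0, 0] = 0 := by simp
    by_cases h0 : v 0 = 0
    · by_cases h1 : v 1 = 0
      · have h2 : v 2 ≠ 0 := by
          intro h2
          apply hv
          ext i
          fin_cases i <;> assumption
        refine ⟨fun c => ![c 0, c 1, c 3], h000, hsub 0 1 3, fun c hc hq hp => ?_⟩
        have a0 : c 0 = 0 := congrFun hc 0
        have a1 : c 1 = 0 := congrFun hc 1
        have a3 : c 3 = 0 := congrFun hc 2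
        have p0 := hp ![1, 0, 0]
        have p1 := hp ![0, 1, 0]
        simp [quadPolar, h0, h1, h2] at p0 p1
        simp [quadForm, h0, h1, h2] at hq
        ext i
        fin_cases i <;> assumption
      · refine ⟨fun c => ![c 0, c 2, c 5], h000, hsub 0 2 5, fun c hc hq hp => ?_⟩
        have a0 : c 0 = 0 := congrFun hc 0
        have a2 : c 2 = 0 := congrFun hc 1
        have a5 : c 5 = 0 := congrFun hc 2
        have p0 := hp ![1, 0, 0]
        have p1 := hp ![0, 0, 1]
        simp [quadPolar, h0, h1, a0, a2, a5] at p0 p1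
        simp [quadForm, h0, h1, a0, a2, a5, p0, p1] at hq
        ext i
        fin_cases i <;> assumption
    · refine ⟨fun c => ![c 3, c 4, c 5], h000, hsub 3 4 5, fun c hc hq hp => ?_⟩
      have a3 : c 3 = 0 := congrFun hc 0
      have a4 : c 4 = 0 := congrFun hc 1
      have a5 : c 5 = 0 := congrFun hc 2
      have p0 := hp ![0, 1, 0]
      have p1 := hp ![0, 0, 1]
      simp [quadPolar, h0, a3, a4, a5] at p0 p1
      simp [quadForm, h0, a3, a4, a5, p0, p1] at hq
      ext i
      fin_cases i <;> assumption
  have hcard : (Finset.univ.erase (0 : Fin 3 → F)).card = Fintype.card F ^ 3 - 1 := by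
    rw [Finset.card_erase_of_mem (Finset.mem_univ _), Finset.card_univ, Fintype.card_fun,
      Fintype.card_fin]
  rw [← hcard]
  have hz : quadForm (0 : Fin 6 → F) v = 0 ∧ ∀ w, quadPolar 0 v w = 0 := by
    simp [quadForm, quadPolar]
  refine Finset.card_le_card_of_injOn f ?_ ?_
  · intro c hc
    have hc := (Finset.mem_filter.1 hc).2
    simp only [Finset.coe_erase, Finset.coe_univ, Set.mem_sdiff, Set.mem_univ, true_and,
      Set.mem_singleton_iff]
    exact fun h => hc.1 (hf.2 _ _ (h.trans hf.1.symm) hc.2 hz)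
  · intro c hc c' hc' h
    exact hf.2 _ _ h (Finset.mem_filter.1 hc).2.2 (Finset.mem_filter.1 hc').2.2

open scoped Classical in
/-- A bound for the number of nonzero singular conics. -/
theorem card_not_isSmoothConic_mul_le [Fintype F] :
    (Finset.univ.filter fun c : Fin 6 → F => c ≠ 0 ∧ ¬ IsSmoothConic c).card *
      (Fintype.card F - 1) ≤ (Fintype.card F ^ 3 - 1) * (Fintype.card F ^ 3 - 1) := by
  have hcard : (Finset.univ.erase (0 : Fin 3 → F)).card = Fintype.card F ^ 3 - 1 := by
    rw [Finset.card_erase_of_mem (Finset.mem_univ _), Finset.card_univ, Fintype.card_fun,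
      Fintype.card_fin]
  nth_rw 1 [← hcard]
  -- Incidences between singular conics and vectors representing their singular points are counted:
  -- a conic meets at least `q - 1` such vectors, the multiples of one, and a vector meets at most
  -- `q³ - 1` conics.
  refine Finset.card_mul_le_card_mul
    (fun (c : Fin 6 → F) v => quadForm c v = 0 ∧ ∀ w, quadPolar c v w = 0) ?_ ?_
  · intro c hc
    have hc := (Finset.mem_filter.1 hc).2
    have hs := hc.2
    unfold IsSmoothConic at hs
    push Not at hs
    obtain ⟨v, hv, hq, hp⟩ := hs
    rw [← Fintype.card_units, ← Finset.card_univ]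
    refine Finset.card_le_card_of_injOn (fun r => (r : F) • v) ?_ ?_
    · intro r _
      simp only [Finset.bipartiteAbove, Finset.coe_filter, Set.mem_ofPred_eq, Finset.mem_erase,
        Finset.mem_univ, and_true]
      refine ⟨smul_ne_zero r.ne_zero hv, by rw [quadForm_smul, hq, mul_zero], fun w => ?_⟩
      rw [quadPolar_comm, quadPolar_smul, quadPolar_comm, hp, mul_zero]
    · intro r _ r' _ h
      exact Units.ext (smul_left_injective F hv h)
  · intro v hv
    refine le_trans (Finset.card_le_card ?_) (card_singular_le (Finset.ne_of_mem_erase hv))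
    intro c hc
    simp only [Finset.bipartiteBelow, Finset.mem_filter] at hc ⊢
    exact ⟨Finset.mem_univ _, hc.1.2.1, hc.2⟩

end CountConics

/-! ### Anisotropic ternary cubics over finite fields -/

section Main

variable {F E : Type*} [Field F] [Fintype F] [Field E] [Algebra F E]

/-- The product of `l` with `c - c'` vanishes at all vectors over `E`, hence is zero as a form, and
`l` cancels. Working over `E` matters: over the field with two elements a cubic form is not
determined by its values. -/
theorem IsDecomp.unique (hE : Module.finrank F E = 3) {a : Fin 10 → F} {c c' : Fin 6 → F}
    {l : Fin 3 → F} (hl : l ≠ 0) {m : Fin 3 → E} (h : IsDecomp a c l m)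
    (h' : IsDecomp a c' l m) : c = c' := by
  obtain ⟨t, ht0, ht1⟩ := exists_ne_zero_ne_one F hE
  have hl' : algebraMap F E ∘ l ≠ 0 := by
    intro h0
    apply hl
    ext i
    simpa using congrFun h0 i
  have h1 := cubicForm_eq_zero ht0 ht1
    (a := mulCoeff (algebraMap F E ∘ l) (algebraMap F E ∘ c - algebraMap F E ∘ c')) (by
      intro v
      rw [cubicForm_mulCoeff, quadForm_sub, mul_sub]
      linear_combination h v - h' v)
  have h2 := sub_eq_zero.1 (eq_zero_of_mulCoeff_eq_zero hl' h1)
  ext i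
  exact (algebraMap F E).injective (congrFun h2 i)

/-- A ternary cubic form over a finite field without nontrivial zeros is the norm form of a linear
form over the cubic extension. -/
theorem IsAnisotropic.exists_eq_normForm (hE : Module.finrank F E = 3) {a : Fin 10 → F}
    (ha : IsAnisotropic a) :
    ∃ m : Fin 3 → E, ∀ v, cubicForm (algebraMap F E ∘ a) v = normForm F m v := by
  classical
  have := finite_of_finrank_eq_three F hE
  by_contra! hno
  set q := Fintype.card F with hq
  have hq1 : 1 < q := Fintype.one_lt_card
  -- With `l = 0` the cubic itself would be a norm form.
  have hl0 {c : Fin 6 → F} {l : Fin 3 → F} {m : Fin 3 → E} (h : IsDecomp a c l m) : l ≠ 0 := by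
    rintro rfl
    obtain ⟨v, hv⟩ := hno m
    apply hv
    rw [h v]
    simp [linForm]
  -- The double count: a pair `(c, m)` is sent to `(l, m)`, and `c` can be recovered from the image.
  let f : (Σ c : Fin 6 → F, repSet E a c) →
      (Σ l : {l : Fin 3 → F // l ≠ 0}, {m : Fin 3 → E | ∃ c, IsDecomp a c l m}) :=
    fun p => ⟨⟨p.2.2.choose, hl0 p.2.2.choose_spec⟩, p.2.1, p.1, p.2.2.choose_spec⟩
  have hf : Function.Injective f := by
    rintro ⟨c, m, hm⟩ ⟨c', m', hm'⟩ h
    have h1 : hm.choose = hm'.choose := congrArg (fun p => p.1.1) h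
    have h2 : m = m' := by
      have := congrArg (fun p : (Σ l : {l : Fin 3 → F // l ≠ 0},
        {m : Fin 3 → E | ∃ c, IsDecomp a c l m}) => (p.2 : Fin 3 → E)) h
      exact this
    subst h2
    have h3 := hm'.choose_spec
    rw [← h1] at h3
    obtain rfl := hm.choose_spec.unique hE (hl0 hm.choose_spec) h3
    rfl
  have hle := Nat.card_le_card_of_injective f hf
  rw [Nat.card_sigma, Nat.card_sigma] at hle
  simp only [Nat.card_coe_set_eq] at hle
  have hub : ∑ l : {l : Fin 3 → F // l ≠ 0}, {m : Fin 3 → E | ∃ c, IsDecomp a c l m}.ncard ≤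
      (q ^ 3 - 1) * (3 * (q ^ 2 + q + 1) * q ^ 3) := by
    refine (Finset.sum_le_card_nsmul _ _ _ fun l _ => ncard_setOf_isDecomp_le hE ha l.2).trans ?_
    rw [Finset.card_univ, Fintype.card_subtype_compl, Fintype.card_fun, Fintype.card_fin,
      Fintype.card_subtype_eq, smul_eq_mul]
  set S := Finset.univ.filter fun c : Fin 6 → F => IsSmoothConic c with hS
  set N := Finset.univ.filter fun c : Fin 6 → F => c ≠ 0 ∧ ¬ IsSmoothConic c with hN
  set P := (Finset.univ.filter fun s : Fin 2 → Fin 3 → F => LinearIndependent F s).image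
    fun s => linMul (s 0) (s 1) with hP
  have hind {s : Fin 2 → Fin 3 → F} (hs : LinearIndependent F s) :
      LinearIndependent F ![s 0, s 1] := by
    convert! hs
    ext i : 1
    fin_cases i <;> rfl
  have hdisj : Disjoint S P := by
    rw [Finset.disjoint_left]
    intro c hc hc'
    obtain ⟨s, hs, rfl⟩ := Finset.mem_image.1 hc'
    exact not_isSmoothConic_linMul (hind (Finset.mem_filter.1 hs).2) (Finset.mem_filter.1 hc).2
  have hlb : S.card * (3 * (q ^ 2 + q + 1)) + P.card * (9 * (q ^ 2 + q + 1)) ≤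
      ∑ c : Fin 6 → F, (repSet E a c).ncard := by
    refine le_trans ?_ (Finset.sum_le_sum_of_subset (Finset.subset_univ (S ∪ P)))
    rw [Finset.sum_union hdisj, ← smul_eq_mul S.card, ← smul_eq_mul P.card]
    refine add_le_add (Finset.card_nsmul_le_sum _ _ _ fun c hc => ?_)
      (Finset.card_nsmul_le_sum _ _ _ fun c hc => ?_)
    · exact le_ncard_repSet_of_isSmoothConic hE ha (Finset.mem_filter.1 hc).2
    · obtain ⟨s, hs, rfl⟩ := Finset.mem_image.1 hc
      exact le_ncard_repSet_linMul hE ha (hind (Finset.mem_filter.1 hs).2)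
  have hSN : S.card + N.card + 1 = q ^ 6 := by
    have h0 : ¬ IsSmoothConic (0 : Fin 6 → F) := by
      intro h
      obtain ⟨w, hw⟩ := h ![1, 0, 0] (fun h => one_ne_zero (congrFun h 0)) (by simp [quadForm])
      exact hw (by simp [quadPolar])
    have h1 : N = (Finset.univ.filter fun c : Fin 6 → F => ¬ IsSmoothConic c).erase 0 := by
      ext c
      simp [hN]
    have h2 := Finset.card_filter_add_card_filter_not (s := (Finset.univ : Finset (Fin 6 → F)))
      (fun c => IsSmoothConic c)
    rw [Finset.card_univ, Fintype.card_fun, Fintype.card_fin] at h2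
    have h3 := Finset.card_erase_add_one (s := Finset.univ.filter fun c : Fin 6 → F => ¬ IsSmoothConic c)
      (a := 0) (by simp [h0])
    rw [h1, add_assoc, h3, hS, h2]
  have hNc : N.card * (q - 1) ≤ (q ^ 3 - 1) * (q ^ 3 - 1) := card_not_isSmoothConic_mul_le
  have hPc : (q ^ 3 - 1) * (q ^ 3 - q) ≤ 2 * (q - 1) * P.card := card_linMul_image
  have hfin := hlb.trans (hle.trans hub)
  clear_value S N P q
  generalize S.card = s at *
  generalize N.card = n at *
  generalize P.card = p at *
  have hfin' : s + 3 * p ≤ (q ^ 3 - 1) * q ^ 3 := by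
    have hM : 0 < 3 * (q ^ 2 + q + 1) := by positivity
    refine Nat.le_of_mul_le_mul_left (c := 3 * (q ^ 2 + q + 1)) ?_ hM
    nlinarith [hfin]
  have hq3 : q < q ^ 3 := by nlinarith [Nat.pow_lt_pow_right hq1 (show 1 < 3 by norm_num)]
  obtain ⟨r, rfl⟩ : ∃ r, q = r + 1 := ⟨q - 1, by omega⟩
  zify [show 1 ≤ (r + 1) ^ 3 by omega, hq3.le] at hfin' hNc hPc hSN hq3
  simp only [Nat.add_sub_cancel] at hNc hPc
  have hr : (0 : ℤ) < r := by omega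
  set x : ℤ := (r : ℤ) + 1 with hx
  have hr' : (r : ℤ) = x - 1 := by omega
  rw [hr'] at hNc hPc hr
  -- With `x = q`, the bounds on `s`, `n`, `p` make `2(q - 1)(s + 3p)` exceed `2(q - 1)(q³ - 1)q³`
  -- by at least `(q³ - 1)(q³ - q)`, which `h2` shows to be positive.
  have h1 := mul_le_mul_of_nonneg_left hfin' (by linarith : (0 : ℤ) ≤ 2 * (x - 1))
  have h2 : (0 : ℤ) < (x ^ 3 - 1) * (x ^ 3 - x) := mul_pos (by nlinarith) (by linarith)
  have h3 : 2 * (x - 1) * ((s : ℤ) + n + 1) = 2 * (x - 1) * x ^ 6 := by rw [hSN]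
  nlinarith

end Main

end TernaryCubic

namespace TernaryCubic

/-! ### A cubic form which is permuted cyclically by the Frobenius automorphism -/

section Cyclic

variable (F : Type*) {E : Type*} [Field F] [Fintype F] [Field E] [Algebra F E]

/-- The matrix of the conjugates of a family of three elements of `E`. -/
def conjMatrix (e : Fin 3 → E) : Matrix (Fin 3) (Fin 3) E :=
  Matrix.of ![e, frob F ∘ e, frob F ∘ frob F ∘ e]

/-- The coefficients of the cubic form
`A x²z + A^q y²x + A^(q²) z²y - b y²z - b^q z²x - b^(q²) x²y`. -/
def cyclicCubic (A b : E) : Fin 10 → E :=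
  ![0, -frob F (frob F b), A, frob F A, 0, -frob F b, 0, -b, frob F (frob F A), 0]

theorem conjMatrix_mulVec (e v : Fin 3 → E) :
    (conjMatrix F e).mulVec v =
      ![linForm e v, linForm (frob F ∘ e) v, linForm (frob F ∘ frob F ∘ e) v] := by
  ext i
  fin_cases i <;> simp [conjMatrix, Matrix.mulVec, dotProduct, Fin.sum_univ_three, linForm]

theorem linForm_frob_comp_algebraMap (e : Fin 3 → E) (v : Fin 3 → F) :
    linForm (frob F ∘ e) (algebraMap F E ∘ v) = frob F (linForm e (algebraMap F E ∘ v)) := by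
  simp [linForm]

variable (hE : Module.finrank F E = 3)
include hE

theorem algebraMap_trace (x : E) :
    algebraMap F E (Algebra.trace F E x) = x + frob F x + frob F (frob F x) := by
  have := finite_of_finrank_eq_three F hE
  rw [FiniteField.algebraMap_trace_eq_sum_pow, hE]
  simp only [frob_apply, Finset.sum_range_succ, Finset.sum_range_zero,
    Nat.card_eq_fintype_card]
  ring

/-- The transpose of the matrix times the matrix is the trace matrix of the basis, whose
determinant, the discriminant, is nonzero. -/
theorem isUnit_det_conjMatrix (e : Module.Basis (Fin 3) F E) :
    IsUnit (conjMatrix F e).det := by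
  have := finite_of_finrank_eq_three F hE
  have h : (conjMatrix F e).transpose * conjMatrix F e =
      (Algebra.traceMatrix F e).map (algebraMap F E) := by
    ext i j
    simp [Algebra.traceMatrix_apply, algebraMap_trace F hE, Matrix.mul_apply, Fin.sum_univ_three,
      conjMatrix]
  have h1 := congrArg Matrix.det h
  rw [Matrix.det_mul, Matrix.det_transpose] at h1
  rw [isUnit_iff_ne_zero]
  intro h0
  rw [h0, mul_zero, ← RingHom.mapMatrix_apply, ← RingHom.map_det] at h1
  exact Algebra.discr_not_zero_of_basis F e ((map_eq_zero _).1 h1.symm)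

theorem map_conjMatrix_mulVec (e v : Fin 3 → E) :
    ((conjMatrix F e).map (frob F)).mulVec v =
      ![(conjMatrix F e).mulVec v 1, (conjMatrix F e).mulVec v 2, (conjMatrix F e).mulVec v 0] := by
  have h3 : frob F ∘ frob F ∘ frob F ∘ e = e := by
    ext i; exact frob_frob_frob F hE _
  have h : (conjMatrix F e).map (frob F) = conjMatrix F (frob F ∘ e) := by
    ext i j
    fin_cases i <;> rfl
  rw [h, conjMatrix_mulVec, conjMatrix_mulVec, h3]
  rfl

theorem cubicForm_frob_cyclicCubic (A b : E) (w : Fin 3 → E) :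
    cubicForm (frob F ∘ cyclicCubic F A b) ![w 1, w 2, w 0] = cubicForm (cyclicCubic F A b) w := by
  simp [cubicForm, cyclicCubic, frob_frob_frob F hE]
  ring

/-- Frobenius rotates the rows of `conjMatrix F e` and, on coefficients, rotates the variables of
the cyclic cubic back. The substituted form is therefore Frobenius-invariant. -/
theorem exists_algebraMap_comp_eq_cubicSubst (A b : E) (e : Fin 3 → E) :
    ∃ a : Fin 10 → F,
      algebraMap F E ∘ a = cubicSubst (cyclicCubic F A b) (conjMatrix F e) := by
  obtain ⟨t, ht0, ht1⟩ := exists_ne_zero_ne_one F hE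
  have h : frob F ∘ cubicSubst (cyclicCubic F A b) (conjMatrix F e) =
      cubicSubst (cyclicCubic F A b) (conjMatrix F e) := by
    rw [← sub_eq_zero]
    refine cubicForm_eq_zero ht0 ht1 fun v => ?_
    have h1 := map_cubicSubst (frob F : E →ₐ[F] E).toRingHom (cyclicCubic F A b) (conjMatrix F e)
    have h2 : cubicForm (frob F ∘ cubicSubst (cyclicCubic F A b) (conjMatrix F e)) v =
        cubicForm (cubicSubst (cyclicCubic F A b) (conjMatrix F e)) v := by
      refine (congrArg (cubicForm · v) h1).trans ?_
      rw [cubicForm_cubicSubst, cubicForm_cubicSubst, ← cubicForm_frob_cyclicCubic F hE A b]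
      exact congrArg _ (map_conjMatrix_mulVec F hE e v)
    rw [sub_eq_add_neg]
    simp only [cubicForm, Pi.add_apply, Pi.neg_apply] at h2 ⊢
    linear_combination h2
  have h' (i) := exists_algebraMap_eq F hE (congrFun h i)
  choose a ha using h'
  exact ⟨a, funext ha⟩

/-- For `v ≠ 0` the quotient `-u / v` has norm one, so Hilbert 90 applies. -/
theorem exists_mul_add_mul_frob_eq_zero {u v : E} (h : conjProd F u + conjProd F v = 0) :
    ∃ y : E, y ≠ 0 ∧ u * y + v * frob F y = 0 := by
  by_cases hv : v = 0
  · subst hv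
    have hu : u = 0 := by
      rw [(conjProd_eq_zero F).2 rfl, add_zero] at h
      exact (conjProd_eq_zero F).1 h
    exact ⟨1, one_ne_zero, by simp [hu]⟩
  · have hv' : conjProd F v ≠ 0 := fun h0 => hv ((conjProd_eq_zero F).1 h0)
    have h1 : conjProd F (-u / v) = 1 := by
      have h2 : conjProd F (-u / v) * conjProd F v = conjProd F v := by
        rw [← conjProd_mul, div_mul_cancel₀ _ hv]
        simp only [conjProd, map_neg] at h ⊢
        linear_combination -h
      exact mul_right_cancel₀ hv' (h2.trans (one_mul _).symm)
    obtain ⟨y, hy, hy'⟩ := exists_frob_eq_mul F hE h1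
    refine ⟨y, hy, ?_⟩
    rw [hy']
    field_simp
    ring

/-- A cyclic cubic form has a nontrivial zero of the form `(y, y^q, y^(q²))`. -/
theorem exists_cubicForm_cyclicCubic_eq_zero (A b : E) :
    ∃ y : E, y ≠ 0 ∧
      cubicForm (cyclicCubic F A b) ![y, frob F y, frob F (frob F y)] = 0 := by
  by_contra! hno
  have : FiniteDimensional F E := Module.finite_of_finrank_pos (by omega)
  let e : Module.Basis (Fin 3) F E := Module.finBasisOfFinrankEq F E hE
  set M := conjMatrix F e with hM
  have hdet : IsUnit M.det := isUnit_det_conjMatrix F hE e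
  obtain ⟨a, ha⟩ := exists_algebraMap_comp_eq_cubicSubst F hE A b e
  have hv (v : Fin 3 → F) : linForm e (algebraMap F E ∘ v) = ∑ i, v i • e i := by
    simp [linForm, Fin.sum_univ_three, Algebra.smul_def, mul_comm]
  have hani : IsAnisotropic a := by
    intro v hv0 h0
    have hy : linForm e (algebraMap F E ∘ v) ≠ 0 := by
      rw [hv]
      intro h
      exact hv0 (funext (Fintype.linearIndependent_iff.1 e.linearIndependent v h))
    apply hno _ hy
    have h1 := map_cubicForm (algebraMap F E) a v
    rw [h0, map_zero, ha, cubicForm_cubicSubst, conjMatrix_mulVec, linForm_frob_comp_algebraMap,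
      linForm_frob_comp_algebraMap, linForm_frob_comp_algebraMap] at h1
    exact h1.symm
  obtain ⟨m, hm⟩ := hani.exists_eq_normForm hE
  obtain ⟨n, rfl⟩ : ∃ n, m = M.transpose.mulVec n := ⟨M⁻¹.transpose.mulVec m, by
    rw [Matrix.mulVec_mulVec, ← Matrix.transpose_mul, Matrix.nonsing_inv_mul _ hdet,
      Matrix.transpose_one, Matrix.one_mulVec]⟩
  have hfrob (G : Matrix (Fin 3) (Fin 3) E) (k : Fin 3 → E) :
      frob F ∘ G.transpose.mulVec k = (G.map (frob F)).transpose.mulVec (frob F ∘ k) := by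
    ext i
    simp [Matrix.mulVec, dotProduct]
  -- In the coordinates `w = M v`, Frobenius rotates the rows of `M`, so the conjugate factors are
  -- the conjugates of `n` evaluated at rotations of `w`.
  have key (w : Fin 3 → E) : cubicForm (cyclicCubic F A b) w =
      linForm n w * linForm (frob F ∘ n) ![w 1, w 2, w 0] *
        linForm (frob F ∘ frob F ∘ n) ![w 2, w 0, w 1] := by
    obtain ⟨v, rfl⟩ : ∃ v, w = M.mulVec v := ⟨M⁻¹.mulVec w, by
      rw [Matrix.mulVec_mulVec, Matrix.mul_nonsing_inv _ hdet, Matrix.one_mulVec]⟩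
    have h := hm v
    have hMM (v : Fin 3 → E) : ((M.map (frob F)).map (frob F)).mulVec v =
        ![M.mulVec v 2, M.mulVec v 0, M.mulVec v 1] := by
      have h : M.map (frob F) = conjMatrix F (frob F ∘ e) := by
        ext i j
        fin_cases i <;> rfl
      have h1 := map_conjMatrix_mulVec F hE (frob F ∘ e) v
      rw [← h, map_conjMatrix_mulVec F hE] at h1
      exact h1
    rw [ha, cubicForm_cubicSubst, normForm, hfrob, hfrob, ← linForm_mulVec, ← linForm_mulVec,
      ← linForm_mulVec, hMM, hM, map_conjMatrix_mulVec F hE] at h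
    exact h
  have k1 := key ![1, 0, 0]
  have k2 := key ![1, 1, 0]
  have k3 := key ![1, 0, 1]
  have k4 := key ![0, 1, 1]
  have k5 := key ![1, 1, 1]
  simp [cubicForm, cyclicCubic, linForm] at k1 k2 k3 k4 k5
  suffices h : ∃ y : E, y ≠ 0 ∧ n 0 * y + n 1 * frob F y + n 2 * frob F (frob F y) = 0 by
    obtain ⟨y, hy, h⟩ := h
    exact hno y hy (by rw [key]; simp [linForm, h])
  -- The absent `x³` term makes one of the `n i` vanish. The combination `k2 + k3 + k4 - k5`
  -- isolates the coefficient of `xyz` by inclusion–exclusion; as that term is absent too, the norms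
  -- of the remaining two entries add up to zero.
  rcases k1 with (h0 | h0) | h0 <;> simp only [h0, map_zero] at k2 k3 k4 k5 ⊢
  · obtain ⟨y, hy, h⟩ := exists_mul_add_mul_frob_eq_zero F hE (u := n 1) (v := n 2)
      (by simp only [conjProd]; linear_combination k2 + k3 + k4 - k5)
    refine ⟨frob F (frob F y), by simpa using hy, ?_⟩
    rw [frob_frob_frob F hE]
    linear_combination h
  · obtain ⟨y, hy, h⟩ := exists_mul_add_mul_frob_eq_zero F hE (u := n 0) (v := n 1)
      (by simp only [conjProd]; linear_combination k2 + k3 + k4 - k5)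
    exact ⟨y, hy, by linear_combination h⟩
  · obtain ⟨y, hy, h⟩ := exists_mul_add_mul_frob_eq_zero F hE (u := n 2) (v := n 0)
      (by simp only [conjProd]; linear_combination k2 + k3 + k4 - k5)
    refine ⟨frob F y, by simpa using hy, ?_⟩
    rw [frob_frob_frob F hE]
    linear_combination h

/-- Every pair `A`, `b` admits `x` of norm one with `Tr (A x⁻¹) = Tr (b x)`. -/
theorem exists_trace_eq (A b : E) :
    ∃ x : E, conjProd F x = 1 ∧ Algebra.trace F E (A * x⁻¹) = Algebra.trace F E (b * x) := by
  obtain ⟨y, hy, h⟩ := exists_cubicForm_cyclicCubic_eq_zero F hE A b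
  have h1 : frob F y ≠ 0 := (map_ne_zero _).2 hy
  have h2 : frob F (frob F y) ≠ 0 := (map_ne_zero _).2 h1
  -- Multiplying the trace equation for `x = y^q / y` by `y y^q y^(q²)` turns it into the vanishing
  -- of the cyclic cubic.
  refine ⟨frob F y / y, ?_, ?_⟩
  · simp only [conjProd, map_div₀, frob_frob_frob F hE]
    field_simp
  · apply (algebraMap F E).injective
    rw [algebraMap_trace F hE, algebraMap_trace F hE]
    simp only [map_mul, map_div₀, map_inv₀, frob_frob_frob F hE]
    simp [cubicForm, cyclicCubic] at h
    field_simp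
    linear_combination h

end Cyclic

end TernaryCubic

namespace SymplecticOvoid

open TernaryCubic
open scoped LinearAlgebra.Projectivization

/-! ### Partial ovoids of the polar space of an alternating form -/

section PolarSpace

variable {F V : Type*} [Field F] [AddCommGroup V] [Module F V] {B : LinearMap.BilinForm F V}

theorem exists_isGenerator_ge [Finite V] {U : Submodule F V} (hU : IsTotallyIsotropic B U) :
    ∃ G, U ≤ G ∧ IsGenerator B G :=
  have : Finite (Submodule F V) := Finite.of_injective _ SetLike.coe_injective
  Finite.exists_le_maximal hU

theorem isTotallyIsotropic_span_pair (hB : B.IsAlt) {v w : V} (h : B v w = 0) :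
    IsTotallyIsotropic B (Submodule.span F {v, w}) := by
  intro x hx y hy
  obtain ⟨r, s, rfl⟩ := Submodule.mem_span_pair.1 hx
  obtain ⟨r', s', rfl⟩ := Submodule.mem_span_pair.1 hy
  have h' : B w v = 0 := by rw [← LinearMap.IsAlt.neg hB v w, h, neg_zero]
  simp [hB v, hB w, h, h']

theorem isTotallyIsotropic_submodule (hB : B.IsAlt) (P : ℙ F V) :
    IsTotallyIsotropic B P.submodule := by
  have h := isTotallyIsotropic_span_pair hB (hB P.rep)
  rwa [Set.pair_eq_singleton, ← Projectivization.submodule_eq] at h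

/-- Points which are pairwise non-orthogonal form a partial ovoid. -/
theorem isPartialOvoid_of_forall (hB : B.IsAlt) {O : Set (ℙ F V)}
    (h : ∀ P ∈ O, ∀ Q ∈ O, B P.rep Q.rep = 0 → P = Q) : IsPartialOvoid B O := by
  refine ⟨fun P _ => isTotallyIsotropic_submodule hB P, fun G hG P hP Q hQ hPG hQG => ?_⟩
  refine h P hP Q hQ (hG.prop _ (hPG ?_) _ (hQG ?_)) <;>
  · rw [Projectivization.submodule_eq]
    exact Submodule.mem_span_singleton_self _

/-- Two points of a partial ovoid which are orthogonal are equal. -/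
theorem IsPartialOvoid.eq_of_orthogonal [Finite V] (hB : B.IsAlt) {O : Set (ℙ F V)}
    (hO : IsPartialOvoid B O) {v w : V} {hv : v ≠ 0} {hw : w ≠ 0}
    (hP : Projectivization.mk F v hv ∈ O) (hQ : Projectivization.mk F w hw ∈ O)
    (h : B v w = 0) : Projectivization.mk F v hv = Projectivization.mk F w hw := by
  obtain ⟨G, hG, hG'⟩ := exists_isGenerator_ge (isTotallyIsotropic_span_pair hB h)
  refine hO.2 G hG' _ hP _ hQ ?_ ?_ <;>
  · rw [Projectivization.submodule_mk]
    exact (Submodule.span_mono (by simp)).trans hG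

end PolarSpace

/-! ### The symplectic form on `W` and the group `K` -/

section Orbit

variable (F : Type*) {E : Type*} [Field F] [Fintype F] [Field E] [Algebra F E]

/-- The parametrization of `W` by pairs of elements of `E`. -/
noncomputable def wequiv : (E × E) ≃ₗ[F] W F E :=
  LinearEquiv.ofBijective
    ({
      toFun := fun p => wvec F p.1 p.2
      map_add' := fun p p' => Subtype.ext (vec_add F p.1 p.2 p'.1 p'.2).symm
      map_smul' := fun r p => Subtype.ext (vec_smul F r p.1 p.2).symm } : (E × E) →ₗ[F] W F E)
    ⟨by
      intro p p' h
      have h1 : vec F p.1 p.2 = vec F p'.1 p'.2 := congrArg Subtype.val h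
      exact Prod.ext (by simpa [vec] using congrFun h1 0) (by simpa [vec] using congrFun h1 5), by
      rintro ⟨_, a, b, rfl⟩
      exact ⟨(a, b), rfl⟩⟩

theorem exists_eq_wvec (v : W F E) : ∃ a b : E, v = wvec F a b := by
  obtain ⟨_, a, b, rfl⟩ := v
  exact ⟨a, b, rfl⟩

theorem mem_normOne {x : Eˣ} : x ∈ normOne F E ↔ conjProd F (x : E) = 1 := by
  rw [conjProd_eq_pow, normOne, MonoidHom.mem_ker, powMonoidHom_apply, Units.ext_iff]
  simp

theorem homD_smul_point (x : Eˣ) {a b : E} (h : a ≠ 0 ∨ b ≠ 0) :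
    homD F E x • point F a b h = point F (x * a) ((x : E)⁻¹ * b) (by simpa using h) := by
  rw [point, Projectivization.smul_mk]
  exact Projectivization.mk_eq_mk_iff' F _ _ _ _ |>.2 ⟨1, by rw [one_smul]; exact (endD_wvec F x a b).symm⟩

theorem exists_eq_point (P : ℙ F (W F E)) : ∃ (a b : E) (h : a ≠ 0 ∨ b ≠ 0), P = point F a b h := by
  induction P using Projectivization.ind with
  | h v hv =>
    obtain ⟨a, b, rfl⟩ := exists_eq_wvec F v
    refine ⟨a, b, ?_, rfl⟩
    by_contra! h
    obtain ⟨rfl, rfl⟩ := h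
    exact hv ((wequiv F).map_zero)

theorem orbitO_eq_range (c : F) :
    orbitO F (E := E) c = Set.range fun x : normOne F E =>
      point F (((x : Eˣ) : E) * 1) (((x : Eˣ) : E)⁻¹ * algebraMap F E c) (by simp) := by
  ext P
  constructor
  · rintro ⟨⟨_, x, hx, rfl⟩, rfl⟩
    exact ⟨⟨x, hx⟩, (homD_smul_point F x (Or.inl one_ne_zero)).symm⟩
  · rintro ⟨⟨x, hx⟩, rfl⟩
    exact ⟨⟨_, x, hx, rfl⟩, homD_smul_point F x (Or.inl one_ne_zero)⟩

variable (hE : Module.finrank F E = 3)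

theorem form_wvec (a b a' b' : E) : form F hE (wvec F a b) (wvec F a' b') =
    Algebra.trace F E (a * b') - Algebra.trace F E (b * a') := by
  apply (algebraMap F E).injective
  rw [algebraMap_form, map_sub, algebraMap_trace F hE, algebraMap_trace F hE]
  simp [beta, wvec, vec, frob_apply, ← pow_mul, ← pow_two]
  ring

theorem isAlt_form : (form F hE).IsAlt := by
  intro v
  obtain ⟨a, b, rfl⟩ := exists_eq_wvec F v
  rw [form_wvec, mul_comm, sub_self]

include hE in
theorem finrank_W : Module.finrank F (W F E) = 6 := by
  have : FiniteDimensional F E := Module.finite_of_finrank_pos (by omega)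
  rw [← (wequiv F (E := E)).finrank_eq, Module.finrank_prod, hE]

theorem nondegenerate_form : (form F hE).Nondegenerate := by
  have := finite_of_finrank_eq_three F hE
  rw [LinearMap.BilinForm.Nondegenerate, (isAlt_form F hE).isRefl.nondegenerate_iff_separatingLeft]
  have htr (a : E) (h : ∀ b, Algebra.trace F E (a * b) = 0) : a = 0 :=
    (traceForm_nondegenerate F E).1 a h
  intro v hv
  obtain ⟨a, b, rfl⟩ := exists_eq_wvec F v
  obtain rfl : a = 0 := htr a fun b' => by simpa [form_wvec] using hv (wvec F 0 b')
  obtain rfl : b = 0 := htr b fun a' => by simpa [form_wvec] using hv (wvec F a' 0)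
  exact (wequiv F).map_zero

theorem form_endD (x : Eˣ) (v w : W F E) :
    form F hE (endD F x v) (endD F x w) = form F hE v w := by
  obtain ⟨a, b, rfl⟩ := exists_eq_wvec F v
  obtain ⟨a', b', rfl⟩ := exists_eq_wvec F w
  rw [endD_wvec, endD_wvec, form_wvec, form_wvec]
  congr 2 <;> field_simp

-- For `N(z) = 1` the second elementary symmetric function of the conjugates of `z` is `Tr z⁻¹`, so
-- `N(1 - z) = 1 - Tr z + Tr z⁻¹ - 1 = 0`.
include hE in
theorem eq_one_of_trace_eq_trace_inv {z : E} (hz : conjProd F z = 1)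
    (h : Algebra.trace F E z = Algebra.trace F E z⁻¹) : z = 1 := by
  have hz0 : z ≠ 0 := by
    rintro rfl
    rw [(conjProd_eq_zero F).2 rfl] at hz
    exact zero_ne_one hz
  have hinv : z⁻¹ = frob F z * frob F (frob F z) :=
    inv_eq_of_mul_eq_one_right (by rw [← hz, conjProd, mul_assoc])
  have h1 := congrArg (algebraMap F E) h
  rw [algebraMap_trace F hE, algebraMap_trace F hE, hinv] at h1
  simp only [map_mul, frob_frob_frob F hE] at h1
  have h2 : conjProd F (1 - z) = 0 := by
    simp only [conjProd, map_sub, map_one] at hz ⊢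
    linear_combination -h1 - hz
  exact (sub_eq_zero.1 ((conjProd_eq_zero F).1 h2)).symm

/-- The value of the form is `c (Tr (x/y) - Tr (y/x))`, and `x/y` has norm one. -/
theorem eq_of_form_eq_zero {c : F} (hc : c ≠ 0) {x y : Eˣ} (hx : x ∈ normOne F E)
    (hy : y ∈ normOne F E)
    (h : form F hE (wvec F ((x : E) * 1) ((x : E)⁻¹ * algebraMap F E c))
      (wvec F ((y : E) * 1) ((y : E)⁻¹ * algebraMap F E c)) = 0) : x = y := by
  have hxy := (mem_normOne F).1 (div_mem hx hy)
  have h1 : Algebra.trace F E ((x / y : Eˣ) : E) = Algebra.trace F E ((x / y : Eˣ) : E)⁻¹ := by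
    rw [form_wvec, sub_eq_zero] at h
    have e1 : (x : E) * 1 * ((y : E)⁻¹ * algebraMap F E c) = c • ((x / y : Eˣ) : E) := by
      rw [Algebra.smul_def, Units.val_div_eq_div_val]
      field_simp
    have e2 : (x : E)⁻¹ * algebraMap F E c * ((y : E) * 1) = c • ((x / y : Eˣ) : E)⁻¹ := by
      rw [Algebra.smul_def, Units.val_div_eq_div_val]
      field_simp
    rw [e1, e2, map_smul, map_smul] at h
    exact smul_right_injective F hc h
  exact div_eq_one.1 (Units.ext (eq_one_of_trace_eq_trace_inv F hE hxy h1))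

-- Equal points are orthogonal because the form is alternating, so `eq_of_form_eq_zero` applies.
include hE in
theorem injective_orbit_point {c : F} (hc : c ≠ 0) :
    Function.Injective fun x : normOne F E =>
      point F (((x : Eˣ) : E) * 1) (((x : Eˣ) : E)⁻¹ * algebraMap F E c) (by simp) := by
  rintro ⟨x, hx⟩ ⟨y, hy⟩ h
  obtain ⟨r, hr⟩ := (Projectivization.mk_eq_mk_iff' F _ _ _ _).1 h
  refine Subtype.ext (eq_of_form_eq_zero F hE hc hx hy ?_)
  rw [← hr, map_smul, LinearMap.smul_apply, isAlt_form F hE, smul_zero]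

include hE in
theorem natCard_normOne : Nat.card (normOne F E) = Fintype.card F ^ 2 + Fintype.card F + 1 := by
  rw [← natCard_conjProd_eq F hE one_ne_zero]
  refine Nat.card_congr (Equiv.ofBijective
    (fun x => ⟨(x : Eˣ), by rw [map_one]; exact (mem_normOne F).1 x.2⟩) ⟨?_, ?_⟩)
  · intro x y h
    exact Subtype.ext (Units.ext (congrArg Subtype.val h))
  · rintro ⟨u, hu⟩
    rw [map_one] at hu
    have hu0 : u ≠ 0 := by
      rintro rfl
      rw [(conjProd_eq_zero F).2 rfl] at hu
      exact zero_ne_one hu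
    exact ⟨⟨Units.mk0 u hu0, (mem_normOne F).2 hu⟩, rfl⟩

include hE in
theorem isCyclic_K : IsCyclic (K F E) := by
  have := finite_of_finrank_eq_three F hE
  exact isCyclic_of_surjective _ (MonoidHom.subgroupMap_surjective
    ((MulAction.toPermHom (LinearMap.GeneralLinearGroup F (W F E)) (ℙ F (W F E))).comp
      (homD F E)) (normOne F E))

-- Distinct elements of norm one already move `P_{1,1}` to distinct points, so they induce distinct
-- projectivities.
include hE in
theorem natCard_K : Nat.card (K F E) = Fintype.card F ^ 2 + Fintype.card F + 1 := by
  rw [← natCard_normOne F hE]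
  symm
  refine Nat.card_congr (Equiv.ofBijective (MonoidHom.subgroupMap
    ((MulAction.toPermHom (LinearMap.GeneralLinearGroup F (W F E)) (ℙ F (W F E))).comp
      (homD F E)) (normOne F E)) ⟨?_, MonoidHom.subgroupMap_surjective _ _⟩)
  intro x y h
  apply injective_orbit_point F hE one_ne_zero
  have h1 := congrArg Subtype.val h
  have h2 := DFunLike.congr_fun h1 (point F (1 : E) (algebraMap F E 1) (Or.inl one_ne_zero))
  have h3 (z : normOne F E) := homD_smul_point F (z : Eˣ) (a := 1) (b := algebraMap F E 1)
    (Or.inl one_ne_zero)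
  exact (h3 x).symm.trans (Eq.trans h2 (h3 y))

/-! ### Size, partial ovoid property and maximality of the orbit. -/

include hE in
theorem ncard_orbitO {c : F} (hc : c ≠ 0) :
    (orbitO F (E := E) c).ncard = Fintype.card F ^ 2 + Fintype.card F + 1 := by
  rw [orbitO_eq_range, ← natCard_normOne F hE, ← Nat.card_coe_set_eq]
  exact Nat.card_range_of_injective (injective_orbit_point F hE hc)

theorem isPartialOvoid_orbitO {c : F} (hc : c ≠ 0) :
    IsPartialOvoid (form F hE) (orbitO F (E := E) c) := by
  rw [orbitO_eq_range]
  refine isPartialOvoid_of_forall (isAlt_form F hE) ?_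
  rintro _ ⟨⟨x, hx⟩, rfl⟩ _ ⟨⟨y, hy⟩, rfl⟩ h
  have hrep (v : W F E) (hv : v ≠ 0) : ∃ r : F, v = r • (Projectivization.mk F v hv).rep := by
    obtain ⟨r, hr⟩ := Projectivization.exists_smul_eq_mk_rep F v hv
    exact ⟨(r⁻¹ : Fˣ), by rw [← hr, ← Units.smul_def, inv_smul_smul]⟩
  have := eq_of_form_eq_zero F hE hc hx hy (by
    obtain ⟨r, hr⟩ := hrep _ (wvec_ne_zero F (a := (x : E) * 1)
      (b := (x : E)⁻¹ * algebraMap F E c) (by simp))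
    obtain ⟨s, hs⟩ := hrep _ (wvec_ne_zero F (a := (y : E) * 1)
      (b := (y : E)⁻¹ * algebraMap F E c) (by simp))
    rw [hr, hs, map_smul, map_smul, LinearMap.smul_apply]
    exact mul_eq_zero_of_right _ (mul_eq_zero_of_right _ h))
  subst this
  rfl

theorem isMaximalPartialOvoid_orbitO {c : F} (hc : c ≠ 0) :
    IsMaximalPartialOvoid (form F hE) (orbitO F (E := E) c) := by
  have := finite_of_finrank_eq_three F hE
  refine ⟨isPartialOvoid_orbitO F hE hc, fun O hO hle P hP => ?_⟩
  obtain ⟨a, b, hab, rfl⟩ := exists_eq_point F P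
  -- The form of `P_{a,b}` with the orbit point `P_{x, c/x}` is `Tr(c a x⁻¹) - Tr(b x)`. Orthogonal
  -- points of the partial ovoid `O` coincide, so `P_{a,b}` lies in the orbit.
  obtain ⟨x, hx, h⟩ := exists_trace_eq F hE (c • a) b
  have hx0 : x ≠ 0 := by
    rintro rfl
    rw [(conjProd_eq_zero F).2 rfl] at hx
    exact zero_ne_one hx
  have hQ : point F (x * 1) (x⁻¹ * algebraMap F E c) (by simp [hx0]) ∈ orbitO F (E := E) c := by
    rw [orbitO_eq_range]
    exact ⟨⟨Units.mk0 x hx0, (mem_normOne F).2 hx⟩, rfl⟩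
  refine Set.mem_of_eq_of_mem (hO.eq_of_orthogonal (isAlt_form F hE) hP (hle hQ) (by
    rw [form_wvec, sub_eq_zero, mul_one, ← h, Algebra.smul_def]
    congr 1
    ring)) hQ

end Orbit

end SymplecticOvoid

theorem mainTheorem7 {F E : Type*} [Field F] [Fintype F] [Field E] [Algebra F E]
    (hE : Module.finrank F E = 3) :
    (Module.finrank F (SymplecticOvoid.W F E) = 6 ∧
      (SymplecticOvoid.form F hE).IsAlt ∧
      (SymplecticOvoid.form F hE).Nondegenerate) ∧
    (IsCyclic (SymplecticOvoid.K F E) ∧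
      Nat.card (SymplecticOvoid.K F E) = Fintype.card F ^ 2 + Fintype.card F + 1 ∧
      ∀ x ∈ SymplecticOvoid.normOne F E, ∀ v w : SymplecticOvoid.W F E,
        SymplecticOvoid.form F hE (SymplecticOvoid.endD F x v) (SymplecticOvoid.endD F x w) =
          SymplecticOvoid.form F hE v w) ∧
    ∀ c : F, c ≠ 0 →
      SymplecticOvoid.IsPartialOvoid (SymplecticOvoid.form F hE)
        (SymplecticOvoid.orbitO F (E := E) c) ∧
      (SymplecticOvoid.orbitO F (E := E) c).ncard =
        Fintype.card F ^ 2 + Fintype.card F + 1 ∧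
      SymplecticOvoid.IsMaximalPartialOvoid (SymplecticOvoid.form F hE)
        (SymplecticOvoid.orbitO F (E := E) c) :=
  ⟨⟨SymplecticOvoid.finrank_W F hE, SymplecticOvoid.isAlt_form F hE,
      SymplecticOvoid.nondegenerate_form F hE⟩,
    ⟨SymplecticOvoid.isCyclic_K F hE, SymplecticOvoid.natCard_K F hE,
      fun x _ v w => SymplecticOvoid.form_endD F hE x v w⟩,
    fun _ hc => ⟨SymplecticOvoid.isPartialOvoid_orbitO F hE hc, SymplecticOvoid.ncard_orbitO F hE hc,
      SymplecticOvoid.isMaximalPartialOvoid_orbitO F hE hc⟩⟩
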